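/- **Conventions.** For a cartesian monad $T$ on a category $\mathcal E$ with finite limits, a $T$-graph is a span $T C_0 \xleftarrow{d} C_1 \xrightarrow{c} C_0$; a $T$-multicategory is a $T$-graph with morphisms $C_0 \to C_1$ (identities) and $TC_1 \times_{TC_0} C_1 \to C_1$ (composition) compatible with domains and codomains and satisfying the identity and associativity axioms, i.e. a monad in the bicategory of $T$-spans; a $T$-operad is a $T$-multicategory with $C_0 = 1$. Define sets $S_n$ and monads $T_n$ on $\mathbf{Set}/S_n$ ($n\in\mathbb N$) by: $S_0 = 1$ and $T_0$ is the identity monad on $\mathbf{Set} = \mathbf{Set}/1$; $S_{n+1}$ is the underlying set of $T_n 1$ (so that a $T_n$-graph on $1$ is an object of $\mathbf{Set}/S_{n+1}$) and $T_{n+1}$ is the free $T_n$-operad monad on $\mathbf{Set}/S_{n+1}$. Let $M$ be the free commutative monoid monad (finite multisets) on $\mathbf{Set}$ and $U : \mathbf{Set}/S_n \to \mathbf{Set}$ the forgetful functor. An element of $T_n X$ is a pasting diagram with finitely many positions labelled by elements of $X$; let $\theta_X : U T_n X \to M U X$ send it to the multiset of its labels. **Proposition.** Let $n \in \mathbb N$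 and let $W$ be a symmetric monoidal category with set of objects $W_0$. 1. $\theta$ is a natural transformation $U T_n \to M U$, and $(U,\theta)$ is a monad opfunctor $(\mathbf{Set}/S_n, T_n) \to (\mathbf{Set}, M)$, that is, $\theta$ is compatible with the units and the multiplications of $T_n$ and $M$. 2. There are functions $M(W_0) \to W_0$ which send each finite multiset of objects of $W$ to a tensor product of its elements in some order and bracketing (possibly with unit objects inserted). For every such function, and every element $t$ of $T_n$ labelled in $W_0$, there is an order and bracketing of the positions of $t$ which realizes the object chosen for the multiset of labels of $t$. Call a function together with a selection of these orders and bracketings a *tensor choice*, and write $\otimes t$ for the object chosen for the image of $t \in T_n(W_0 \times S_n)$ under $U T_n(W_0\times S_n) \xrightarrow{\theta} M(W_0 \times S_n) \to M(W_0)$. 3. For every tensor choice there is a $T_n$-multicategory $V$ as follows. Its object of objects is the projection $W_0 \times S_n \to S_n$. An arrow of $V$ with domain $t \in T_n(W_0\times S_n)$ over $s \in S_n$ and codomain $(w,s)$ is a morphism $\otimes t \to w$ in $W$. The identity on $(w,s)$ is the structural isomorphism $\otimes \eta(w,s) \to w$, where $\eta$ is the unit of $T_n$. The composite of a diagram of arrows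 $k_i : \otimes t_i \to w_i$ with an arrow $g : \otimes t \to w$, where $t$ is the diagram of the codomains of the $k_i$, is the composite of the structural isomorphism (built from associativity, unit and symmetry isomorphisms and given by the correspondence of positions) from the tensor product of the composite diagram of the $t_i$ to the tensor product, in the order and bracketing chosen for $t$, of the objects $\otimes t_i$, followed by the tensor product of the $k_i$ and then by $g$. 4. $V$ is canonical up to isomorphism: if $V$ and $V'$ arise from two tensor choices, then the identity on objects together with composition with the structural isomorphisms $\otimes' t \cong \otimes t$ on arrows is an isomorphism of $T_n$-multicategories $V \to V'$. -/

import Mathlib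

/-!
# Opetopes, `T_n`-multicategories and symmetric monoidal categories

Contents.

1. Finitary polynomial monads on `Set/S`, the free-operad ("slice") construction on them, and the
   resulting sequence of sets `S_n` and monads `T_n` on `Set/S_n`.
2. The monad on `Over S` (the category `Set/S`) given by a polynomial monad, and the comparison `θ`
   with the free commutative monoid monad.
3. Monad opfunctors, and multicategories for a monad (diagrams `T C₀ ← C₁ → C₀` with identities
   and composition).
4. Tensor products of finite families of objects in a symmetric monoidal category, in an arbitrary
   order and with an arbitrary bracketing, and the structural isomorphisms between them.
5. The multicategory data attached to a symmetric monoidal category.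
-/

universe w u v

/-! ## 1. Polynomial monads and opetopes -/

/-- The underlying data of a finitary polynomial endofunctor of `Set/S`: a set `S` of colours, a
set `Op` of operations, and for every operation a finite set of input positions `Ar o`, the colour
`src o i` of each input and the colour `tgt o` of the output. -/
structure PolySig : Type (w + 1) where
  S : Type w
  Op : Type w
  Ar : Op → Type w
  tgt : Op → S
  src : (o : Op) → Ar o → S
  finite_ar : ∀ o, Finite (Ar o)

namespace PolySig

/-- An operation with its inputs labelled by elements of `X`. -/
abbrev Lab (P : PolySig.{w}) (X : Type w) : Type w := Σ o : P.Op, (P.Ar o → X)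

end PolySig

/-- A polynomial endofunctor together with the operations of a (cartesian) monad structure:
* for each colour `s` a unary unit operation `unit s`, with input and output of colour `s`;
* for an operation `o` and operations `ρ i`, one for each input `i` of `o` and with matching
  colours, the composite operation `sub o ρ`, which has the same output colour as `o` and whose
  inputs are (via `pos`) the pairs of an input `i` of `o` and an input of `ρ i`. -/
structure PolyData : Type (w + 1) extends PolySig.{w} where
  unit : S → Op
  tgt_unit : ∀ s, tgt (unit s) = s
  pt : ∀ s, Ar (unit s)
  eq_pt : ∀ (s : S) (p : Ar (unit s)), p = pt s
  src_unit : ∀ s, src (unit s) (pt s) = s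
  sub : (o : Op) → (ρ : Ar o → Op) → (∀ i, tgt (ρ i) = src o i) → Op
  tgt_sub : ∀ o ρ h, tgt (sub o ρ h) = tgt o
  pos : (o : Op) → (ρ : Ar o → Op) → (h : ∀ i, tgt (ρ i) = src o i) →
    (Σ i, Ar (ρ i)) ≃ Ar (sub o ρ h)
  src_pos : ∀ o ρ h i q, src (sub o ρ h) (pos o ρ h ⟨i, q⟩) = src (ρ i) q

namespace PolyData

variable (P : PolyData.{w})

/-- Composition of labelled operations: the composite operation, with the induced labelling of
its inputs. This is the multiplication of the monad on labelled operations. -/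
def bind {X : Type w} (o : P.Op) (ρ : P.Ar o → P.Lab X)
    (h : ∀ i, P.tgt (ρ i).1 = P.src o i) : P.Lab X :=
  ⟨P.sub o (fun i => (ρ i).1) h, fun p =>
    (ρ ((P.pos o (fun i => (ρ i).1) h).symm p).1).2 ((P.pos o (fun i => (ρ i).1) h).symm p).2⟩

theorem bind_snd_pos {X : Type w} (o : P.Op) (ρ : P.Ar o → P.Lab X) (h) (i : P.Ar o)
    (q : P.Ar (ρ i).1) :
    (P.bind o ρ h).2 (P.pos o (fun i => (ρ i).1) h ⟨i, q⟩) = (ρ i).2 q := by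
  change (fun z : Σ i, P.Ar (ρ i).1 => (ρ z.1).2 z.2) ((P.pos o _ h).symm (P.pos o _ h ⟨i, q⟩)) = _
  rw [Equiv.symm_apply_apply]

end PolyData

/-- A finitary polynomial monad: composition of operations satisfies the unit and associativity
laws. The laws are equations between labelled operations, so they say that the composite
operations are equal and that their inputs correspond in the evident way. -/
structure PolyMonad : Type (w + 1) extends PolyData.{w} where
  bind_unit_left : ∀ (X : Type w) (s : S) (ρ : Ar (unit s) → toPolySig.Lab X) h,
    toPolyData.bind (unit s) ρ h = ρ (pt s)
  bind_unit_right : ∀ (X : Type w) (o : Op) (f : Ar o → X) h,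
    toPolyData.bind o (fun i => ⟨unit (src o i), fun _ => f i⟩) h = ⟨o, f⟩
  bind_assoc : ∀ (X : Type w) (o : Op) (ρ : Ar o → Op) (h : ∀ i, tgt (ρ i) = src o i)
    (ρ' : Ar (sub o ρ h) → toPolySig.Lab X) (h' : ∀ p, tgt (ρ' p).1 = src (sub o ρ h) p),
    toPolyData.bind (sub o ρ h) ρ' h' =
      toPolyData.bind o
        (fun i => toPolyData.bind (ρ i) (fun q => ρ' (pos o ρ h ⟨i, q⟩))
          (fun q => (h' _).trans (src_pos o ρ h i q)))
        (fun i => (tgt_sub _ _ _).trans (h i))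

namespace PolyMonad

variable (P : PolyMonad.{w})

/-- Formal composites of operations of `P`: a tree is either trivial (`leaf s`, a formal identity
on the colour `s`) or consists of a root operation `o` and a tree grafted on each input of `o`.
Nodes carry labels `x : X`, required to satisfy `D o x` where `o` is the operation at the node, and
leaves carry labels in `Y`. -/
inductive Tree {X : Type w} (D : P.Op → X → Prop) (Y : Type w) : Type w
  | leaf (s : P.S) (y : Y) : Tree D Y
  | node (o : P.Op) (x : X) (hx : D o x) (ch : P.Ar o → Tree D Y) : Tree D Y

namespace Tree

variable {P} {X X' : Type w} {D : P.Op → X → Prop} {D' : P.Op → X' → Prop}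
  {Y Y' Y'' : Type w}

/-- The output colour of a tree. -/
def root : P.Tree D Y → P.S
  | leaf s _ => s
  | node o _ _ _ => P.tgt o

/-- A tree is well typed when the tree grafted on each input has the colour of that input as its
output colour. -/
def WT : P.Tree D Y → Prop
  | leaf _ _ => True
  | node o _ _ ch => ∀ i, (ch i).root = P.src o i ∧ (ch i).WT

/-- The composite in `P` of all the operations in a well-typed tree. Its inputs are the leaves of
the tree; they are labelled by the labels of these leaves. -/
def flat : (t : P.Tree D Y) → t.WT → {z : P.Lab Y // P.tgt z.1 = t.root}
  | leaf s y, _ => ⟨⟨P.unit s, fun _ => y⟩, P.tgt_unit s⟩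
  | node o _ _ ch, h =>
    ⟨P.bind o (fun i => ((ch i).flat (h i).2).1)
      (fun i => ((ch i).flat (h i).2).2.trans (h i).1), P.tgt_sub _ _ _⟩

/-- The composite in `P` of all the operations in a well-typed tree. -/
def shape (t : P.Tree D Y) (h : t.WT) : P.Op := (t.flat h).1.1

/-- Graft a tree on each leaf, according to the label of the leaf. -/
def bindL : P.Tree D Y → (Y → P.Tree D Y') → P.Tree D Y'
  | leaf _ y, u => u y
  | node o x hx ch, u => node o x hx (fun i => (ch i).bindL u)

/-- Relabel the leaves of a tree, which are the inputs of its composite. -/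
def label : (t : P.Tree D Y) → (h : t.WT) → (P.Ar (t.shape h) → Y') → P.Tree D Y'
  | leaf s _, _, f => leaf s (f (P.pt s))
  | node o x hx ch, h, f => node o x hx (fun i => (ch i).label (h i).2
      (fun q => f (P.pos o _ (fun i => ((ch i).flat (h i).2).2.trans (h i).1) ⟨i, q⟩)))

/-- Apply a function to the labels of the leaves. -/
def mapL (φ : Y → Y') : P.Tree D Y → P.Tree D Y'
  | leaf s y => leaf s (φ y)
  | node o x hx ch => node o x hx (fun i => (ch i).mapL φ)

/-- A relation holds between the colour and the label of each leaf. -/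
def AllLeaf (R : P.S → Y → Prop) : P.Tree D Y → Prop
  | leaf s y => R s y
  | node _ _ _ ch => ∀ i, (ch i).AllLeaf R

theorem bindL_bindL (t : P.Tree D Y) (u : Y → P.Tree D Y') (v : Y' → P.Tree D Y'') :
    (t.bindL u).bindL v = t.bindL (fun y => (u y).bindL v) := by
  induction t with
  | leaf s y => rfl
  | node o x hx ch ih => simp only [bindL, ih]

theorem bindL_root (t : P.Tree D Y) (u : Y → P.Tree D Y')
    (hu : t.AllLeaf fun s y => (u y).root = s ∧ (u y).WT) : (t.bindL u).root = t.root := by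
  cases t with
  | leaf s y => exact hu.1
  | node o x hx ch => rfl

theorem bindL_WT (t : P.Tree D Y) (u : Y → P.Tree D Y') (h : t.WT)
    (hu : t.AllLeaf fun s y => (u y).root = s ∧ (u y).WT) : (t.bindL u).WT := by
  induction t with
  | leaf s y => exact hu.2
  | node o x hx ch ih =>
    exact fun i => ⟨(bindL_root _ _ (hu i)).trans (h i).1, ih i (h i).2 (hu i)⟩

theorem allLeaf_src (t : P.Tree D Y) (h : t.WT) (R : P.S → Y → Prop) (ht : t.AllLeaf R)
    (p : P.Ar (t.shape h)) : R (P.src _ p) ((t.flat h).1.2 p) := by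
  induction t with
  | leaf s y =>
    obtain rfl : p = P.pt s := P.eq_pt s p
    have e := P.src_unit s
    change R (P.src (P.unit s) (P.pt s)) y
    rw [e]; exact ht
  | node o x hx ch ih =>
    obtain ⟨⟨i, q⟩, rfl⟩ := (P.pos o _ (fun i => ((ch i).flat (h i).2).2.trans (h i).1)).surjective p
    have e := P.src_pos o _ (fun i => ((ch i).flat (h i).2).2.trans (h i).1) i q
    have := ih i (h i).2 (ht i) q
    change R (P.src (P.sub o _ _) _) _
    rw [e]
    change R _ ((P.toPolyData.bind o (fun i => ((ch i).flat (h i).2).1) _).2 _)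
    rw [P.bind_snd_pos]
    exact this

theorem label_allLeaf (t : P.Tree D Y) (h : t.WT) (f : P.Ar (t.shape h) → Y')
    (R : P.S → Y' → Prop) (hR : ∀ p, R (P.src _ p) (f p)) : (t.label h f).AllLeaf R := by
  induction t with
  | leaf s y =>
    have := hR (P.pt s)
    have e := P.src_unit s
    change R (P.src (P.unit s) (P.pt s)) _ at this
    rw [e] at this; exact this
  | node o x hx ch ih =>
    intro i
    refine ih i (h i).2 _ fun q => ?_
    have := hR (P.pos o _ (fun i => ((ch i).flat (h i).2).2.trans (h i).1) ⟨i, q⟩)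
    have e := P.src_pos o _ (fun i => ((ch i).flat (h i).2).2.trans (h i).1) i q
    change R (P.src (P.sub o _ _) _) _ at this
    rw [e] at this; exact this

theorem label_root (t : P.Tree D Y) (h : t.WT) (f : P.Ar (t.shape h) → Y') :
    (t.label h f).root = t.root := by
  cases t <;> rfl

theorem label_WT (t : P.Tree D Y) (h : t.WT) (f : P.Ar (t.shape h) → Y') :
    (t.label h f).WT := by
  induction t with
  | leaf s y => trivial
  | node o x hx ch ih =>
    exact fun i => ⟨(label_root _ _ _).trans (h i).1, ih i _ _⟩

theorem bind_congr {Z : Type w} {o : P.Op} {ρ ρ' : P.Ar o → P.Lab Z} (e : ∀ i, ρ i = ρ' i)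
    (h : ∀ i, P.tgt (ρ i).1 = P.src o i) :
    P.bind o ρ h = P.bind o ρ' (fun i => e i ▸ h i) := by
  obtain rfl : ρ = ρ' := funext e
  rfl

theorem bind_congr_shape {Z : Type w} {o : P.Op} {ρ : P.Ar o → P.Lab Y} {ρ' : P.Ar o → P.Lab Z}
    (h : ∀ i, P.tgt (ρ i).1 = P.src o i) (h' : ∀ i, P.tgt (ρ' i).1 = P.src o i)
    (e : ∀ i, (ρ i).1 = (ρ' i).1) :
    (P.bind o ρ h).1 = (P.bind o ρ' h').1 := by
  have : (fun i => (ρ i).1) = fun i => (ρ' i).1 := funext e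
  simp only [PolyData.bind, this]

theorem flat_label (t : P.Tree D Y) (h : t.WT) (f : P.Ar (t.shape h) → Y') :
    ((t.label h f).flat (label_WT t h f)).1 = ⟨t.shape h, f⟩ := by
  induction t with
  | leaf s y =>
    simp only [label, flat, shape]
    congr 1
    funext p
    rw [P.eq_pt s p]
  | node o x hx ch ih =>
    simp only [label, flat]
    refine (bind_congr (fun i => ih i (h i).2 _) _).trans ?_
    simp only [PolyData.bind, shape, flat]
    congr 1
    funext p
    exact congrArg f (Equiv.apply_symm_apply _ p)

theorem flat_bindL (t : P.Tree D Y) (u : Y → P.Tree D Y') (h : t.WT)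
    (hu : t.AllLeaf fun s y => (u y).root = s ∧ (u y).WT) :
    ((t.bindL u).flat (bindL_WT t u h hu)).1 =
      P.bind (t.shape h) (fun p => ((u ((t.flat h).1.2 p)).flat (allLeaf_src t h _ hu p).2).1)
        (fun p => ((u ((t.flat h).1.2 p)).flat (allLeaf_src t h _ hu p).2).2.trans
          (allLeaf_src t h _ hu p).1) := by
  induction t with
  | leaf s y =>
    exact (P.bind_unit_left _ s (fun _ => ((u y).flat hu.2).1) _).symm
  | node o x hx ch ih =>
    simp only [bindL, flat]
    refine (bind_congr (fun i => ih i (h i).2 (hu i)) _).trans ?_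
    refine Eq.trans ?_ (P.bind_assoc _ o (fun i => ((ch i).flat (h i).2).1.1) _ _ _).symm
    refine bind_congr (fun i => ?_) _
    refine bind_congr (fun q => ?_) _
    have e := P.bind_snd_pos o (fun i => ((ch i).flat (h i).2).1)
      (fun i => ((ch i).flat (h i).2).2.trans (h i).1) i q
    have key : ∀ y y' (e : y = y') (a : (u y).WT) (b : (u y').WT),
        ((u y).flat a).1 = ((u y').flat b).1 := by
      rintro y _ rfl _ _; rfl
    exact key _ _ e.symm _ _


theorem label_mapL (t : P.Tree D Y) (h : t.WT) (f : P.Ar (t.shape h) → Y') (φ : Y → Y'')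
    (φ' : Y' → Y'') (hφ : ∀ y y', φ y = φ' y') :
    (t.label h f).mapL φ' = t.mapL φ := by
  induction t with
  | leaf s y => simp [label, mapL, hφ y (f (P.pt s))]
  | node o x hx ch ih => simp only [label, mapL, ih]

theorem shape_eq (t : P.Tree D Y) (t' : P.Tree D Y') (h : t.WT) (h' : t'.WT)
    (e : t.mapL (fun _ => PUnit.unit.{w+1}) = t'.mapL (fun _ => PUnit.unit)) :
    t.shape h = t'.shape h' := by
  induction t generalizing t' with
  | leaf s y =>
    cases t' with
    | leaf s' y' => simp only [mapL, leaf.injEq, and_true] at e; subst e; rfl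
    | node => simp [mapL] at e
  | node o x hx ch ih =>
    cases t' with
    | leaf => simp [mapL] at e
    | node o' x' hx' ch' =>
      simp only [mapL, node.injEq] at e
      obtain ⟨rfl, rfl, e⟩ := e
      exact bind_congr_shape _ _ fun i => ih i (ch' i) (h i).2 (h' i).2 (congrFun (eq_of_heq e) i)

theorem bind_inj {Z : Type w} {o : P.Op} {ρ ρ' : P.Ar o → P.Lab Z}
    {h : ∀ i, P.tgt (ρ i).1 = P.src o i} {h' : ∀ i, P.tgt (ρ' i).1 = P.src o i}
    (e : ∀ i, (ρ i).1 = (ρ' i).1) (hb : P.bind o ρ h = P.bind o ρ' h') (i) : ρ i = ρ' i := by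
  obtain ⟨a, f, rfl⟩ : ∃ (a : P.Ar o → P.Op) (f : ∀ i, P.Ar (a i) → Z), ρ = fun i => ⟨a i, f i⟩ :=
    ⟨fun i => (ρ i).1, fun i => (ρ i).2, rfl⟩
  obtain ⟨a', f', rfl⟩ : ∃ (a : P.Ar o → P.Op) (f : ∀ i, P.Ar (a i) → Z),
      ρ' = fun i => ⟨a i, f i⟩ := ⟨fun i => (ρ' i).1, fun i => (ρ' i).2, rfl⟩
  obtain rfl : a = a' := funext e
  have hf := eq_of_heq (Sigma.mk.inj hb).2
  dsimp only
  congr 1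
  funext q
  have := congrFun hf (P.pos o a h ⟨i, q⟩)
  have e1 := P.bind_snd_pos o (fun i => (⟨a i, f i⟩ : P.Lab Z)) h i q
  have e2 := P.bind_snd_pos o (fun i => (⟨a i, f' i⟩ : P.Lab Z)) h i q
  exact e1.symm.trans (this.trans e2)

theorem eq_of_flat (t t' : P.Tree D Y) (h : t.WT) (h' : t'.WT)
    (e : t.mapL (fun _ => PUnit.unit.{w+1}) = t'.mapL (fun _ => PUnit.unit))
    (ef : (t.flat h).1 = (t'.flat h').1) : t = t' := by
  induction t generalizing t' with
  | leaf s y =>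
    cases t' with
    | leaf s' y' =>
      simp only [mapL, leaf.injEq, and_true] at e; subst e
      have := congrFun (eq_of_heq (Sigma.mk.inj ef).2) (P.pt s)
      have this : y = y' := this
      rw [this]
    | node => simp [mapL] at e
  | node o x hx ch ih =>
    cases t' with
    | leaf => simp [mapL] at e
    | node o' x' hx' ch' =>
      simp only [mapL, node.injEq] at e
      obtain ⟨rfl, rfl, e⟩ := e
      have e' := congrFun (eq_of_heq e)
      congr 1
      funext i
      refine ih i _ (h i).2 (h' i).2 (e' i) ?_
      exact bind_inj (fun i => shape_eq _ _ (h i).2 (h' i).2 (e' i)) ef i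

/-- A tree relabelled at its leaves is determined by the unlabelled tree and its composite. -/
theorem eq_label (t' : P.Tree D Y') (h' : t'.WT) (t : P.Tree D PUnit.{w+1}) (h : t.WT)
    (e : t'.mapL (fun _ => PUnit.unit) = t) (f : P.Ar (t.shape h) → Y')
    (ef : (t'.flat h').1 = ⟨t.shape h, f⟩) : t' = t.label h f := by
  refine eq_of_flat _ _ h' (label_WT _ _ _) ?_ (ef.trans (flat_label _ _ _).symm)
  rw [label_mapL t h f (fun _ => PUnit.unit) _ (fun _ _ => rfl), ← e]
  clear ef f h e t h'
  induction t' with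
  | leaf => rfl
  | node o x hx ch ih => simp only [mapL, node.injEq, heq_eq_eq, true_and]; exact funext ih

end Tree

/-- Well-typed trees, without labels at the leaves. -/
@[ext]
structure WTree {X : Type w} (D : P.Op → X → Prop) : Type w where
  tree : P.Tree D PUnit.{w+1}
  wt : tree.WT

/-- The composite in `P` of all the operations in the tree. -/
def WTree.shape {P : PolyMonad.{w}} {X : Type w} {D : P.Op → X → Prop} (r : P.WTree D) : P.Op :=
  r.tree.shape r.wt

/-- A tree may be substituted for a node with operation `o` when its composite is `o`. -/
abbrev Fits {X : Type w} (D : P.Op → X → Prop) : P.Op → P.WTree D → Prop :=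
  fun o r => r.shape = o

/-- Equal operations have the same inputs. -/
def castAr {a b : P.Op} (e : a = b) (p : P.Ar a) : P.Ar b := e ▸ p

namespace Tree

variable {P} {X X' : Type w} {D : P.Op → X → Prop} {D' : P.Op → X' → Prop}
  {Y Y' Y'' : Type w}

/-- Substitution: in a tree whose nodes are labelled by trees, the tree at a node having the
operation at this node as its composite, replace each node by its label. The inputs of the
operation at the node correspond to the leaves of the tree which replaces it. -/
def join : P.Tree (P.Fits D) Y → P.Tree D Y
  | leaf s y => leaf s y
  | node _ r hr ch => (r.tree.label r.wt (P.castAr hr)).bindL (fun i => (ch i).join)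

theorem label_cast_allLeaf {o : P.Op} (r : P.WTree D) (hr : r.shape = o) (R : P.S → P.Ar o → Prop)
    (hR : ∀ i, R (P.src o i) i) : (r.tree.label r.wt (P.castAr hr)).AllLeaf R := by
  subst hr
  exact label_allLeaf _ _ _ _ hR

theorem tgt_shape (r : P.WTree D) : P.tgt r.shape = r.tree.root := (r.tree.flat r.wt).2

theorem join_root_WT (t : P.Tree (P.Fits D) Y) (h : t.WT) : t.join.root = t.root ∧ t.join.WT := by
  induction t with
  | leaf => exact ⟨rfl, trivial⟩
  | node o r hr ch ih =>
    have := label_cast_allLeaf r hr (fun s i => (ch i).join.root = s ∧ (ch i).join.WT)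
      (fun i => ⟨((ih i (h i).2).1).trans (h i).1, (ih i (h i).2).2⟩)
    refine ⟨?_, bindL_WT _ _ (label_WT _ _ _) this⟩
    refine (bindL_root _ _ this).trans ((label_root _ _ _).trans ?_)
    rw [← tgt_shape, hr]; rfl

theorem join_root (t : P.Tree (P.Fits D) Y) (h : t.WT) : t.join.root = t.root :=
  (join_root_WT t h).1

theorem join_WT (t : P.Tree (P.Fits D) Y) (h : t.WT) : t.join.WT := (join_root_WT t h).2

theorem bind_eq_of_lab {Z : Type w} {a : P.Lab Z} {o : P.Op} {f : P.Ar o → Z} (e : a = ⟨o, f⟩)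
    (F : Z → P.Lab Y) (h : ∀ p, P.tgt (F (a.2 p)).1 = P.src a.1 p) :
    P.bind a.1 (fun p => F (a.2 p)) h = P.bind o (fun p => F (f p))
      (by subst e; exact h) := by
  subst e; rfl

theorem flat_join (t : P.Tree (P.Fits D) Y) (h : t.WT) :
    (t.join.flat (join_WT t h)).1 = (t.flat h).1 := by
  induction t with
  | leaf => rfl
  | node o r hr ch ih =>
    have := label_cast_allLeaf r hr (fun s i => (ch i).join.root = s ∧ (ch i).join.WT)
      (fun i => ⟨((join_root _ (h i).2)).trans (h i).1, (join_WT _ (h i).2)⟩)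
    refine (flat_bindL _ _ (label_WT _ _ _) this).trans ?_
    subst hr
    have e := flat_label r.tree r.wt (P.castAr rfl)
    refine (bind_eq_of_lab e (fun p => ((ch p).join.flat (join_WT _ (h p).2)).1) _).trans ?_
    exact bind_congr (fun i => ih i (h i).2) _

theorem join_bindL (t : P.Tree (P.Fits D) Y) (u : Y → P.Tree (P.Fits D) Y') :
    (t.bindL u).join = t.join.bindL (fun y => (u y).join) := by
  induction t with
  | leaf => rfl
  | node o r hr ch ih => simp only [bindL, join, ih, bindL_bindL]

theorem mapL_bindL (t : P.Tree D Y) (u : Y → P.Tree D Y') (φ : Y' → Y'') :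
    (t.bindL u).mapL φ = t.bindL (fun y => (u y).mapL φ) := by
  induction t with
  | leaf => rfl
  | node o x hx ch ih => simp only [bindL, mapL, ih]

theorem join_mapL (t : P.Tree (P.Fits D) Y) (φ : Y → Y') : (t.mapL φ).join = t.join.mapL φ := by
  induction t with
  | leaf => rfl
  | node o x hx ch ih => simp only [join, mapL, mapL_bindL, ih]

theorem mapL_punit (t : P.Tree D PUnit.{w+1}) (φ : PUnit.{w+1} → PUnit.{w+1}) : t.mapL φ = t := by
  induction t with
  | leaf => rfl
  | node o x hx ch ih => simp only [mapL, ih]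

theorem castAr_lab {a o : P.Op} (e : a = o) :
    (⟨a, P.castAr e⟩ : P.Lab (P.Ar o)) = ⟨o, fun i => i⟩ := by subst e; rfl

theorem shape_join (r : P.WTree (P.Fits D)) :
    r.tree.join.shape (join_WT _ r.wt) = r.shape :=
  congrArg Sigma.fst (flat_join r.tree r.wt)

/-- Composing the labels of a tree of trees of trees. -/
def joinMap : P.Tree (P.Fits (P.Fits D)) Y → P.Tree (P.Fits D) Y
  | leaf s y => leaf s y
  | node o r hr ch =>
    node o ⟨r.tree.join, join_WT _ r.wt⟩ ((shape_join r).trans hr) (fun i => (ch i).joinMap)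

theorem join_join (t : P.Tree (P.Fits (P.Fits D)) Y) : t.join.join = t.joinMap.join := by
  induction t with
  | leaf => rfl
  | node o r hr ch ih =>
    simp only [join, joinMap, join_bindL, ih]
    congr 1
    refine eq_label _ (join_WT _ (label_WT _ _ _)) _ _ ?_ _ ?_
    · rw [← join_mapL, label_mapL r.tree r.wt _ (fun _ => PUnit.unit) _ (fun _ _ => rfl), mapL_punit]
    · rw [flat_join _ (label_WT _ _ _), flat_label]
      exact (castAr_lab hr).trans (castAr_lab ((shape_join r).trans hr)).symm

/-- The tree with one node. -/
def corolla (o : P.Op) (x : X) (hx : D o x) : P.Tree D PUnit.{w+1} :=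
  node o x hx (fun i => leaf (P.src o i) PUnit.unit)

theorem corolla_WT (o : P.Op) (x : X) (hx : D o x) : (corolla o x hx).WT := fun _ => ⟨rfl, trivial⟩

theorem corolla_flat (o : P.Op) (x : X) (hx : D o x) :
    ((corolla o x hx).flat (corolla_WT o x hx)).1 = ⟨o, fun _ => PUnit.unit⟩ :=
  P.bind_unit_right _ o (fun _ => PUnit.unit) _

theorem corolla_shape (o : P.Op) (x : X) (hx : D o x) :
    (corolla o x hx).shape (corolla_WT o x hx) = o := congrArg Sigma.fst (corolla_flat o x hx)

theorem bindL_leaf (t : P.Tree D Y) (u : Y → P.S) (h : t.AllLeaf (fun s y => u y = s)) :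
    t.bindL (fun y => leaf (u y) PUnit.unit.{w+1}) = t.mapL (fun _ => PUnit.unit) := by
  induction t with
  | leaf s y => simp only [AllLeaf] at h; simp [bindL, mapL, h]
  | node o x hx ch ih =>
    simp only [bindL, mapL, node.injEq, heq_eq_eq, true_and]
    exact funext fun i => ih i (h i)

theorem join_corolla (o : P.Op) (r : P.WTree D) (hr : r.shape = o) :
    (corolla (D := P.Fits D) o r hr).join = r.tree := by
  simp only [corolla, join]
  rw [bindL_leaf _ _ (label_cast_allLeaf r hr _ fun i => rfl),
    label_mapL r.tree r.wt _ (fun _ => PUnit.unit) _ (fun _ _ => rfl), mapL_punit]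

/-- Labelling each node by a corolla. -/
def corollaMap : P.Tree D Y → P.Tree (P.Fits D) Y
  | leaf s y => leaf s y
  | node o x hx ch => node o ⟨corolla o x hx, corolla_WT o x hx⟩ (corolla_shape o x hx)
      (fun i => (ch i).corollaMap)

theorem castAr_eq {a o : P.Op} (e : a = o) (g : P.Ar a → P.Ar o)
    (eg : (⟨a, g⟩ : P.Lab (P.Ar o)) = ⟨o, fun i => i⟩) : P.castAr e = g := by
  subst e
  exact (eq_of_heq (Sigma.mk.inj eg).2).symm

theorem join_corollaMap (t : P.Tree D Y) : t.corollaMap.join = t := by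
  induction t with
  | leaf => rfl
  | node o x hx ch ih =>
    simp only [corollaMap, join, ih]
    have e := castAr_eq (corolla_shape o x hx) _
      (P.bind_unit_right _ o (fun i => i) (fun i => P.tgt_unit _))
    rw [e]
    simp only [corolla, label, bindL, node.injEq, heq_eq_eq, true_and]
    funext i
    exact congrArg ch (P.bind_snd_pos o (fun i => ⟨P.unit (P.src o i), fun _ => i⟩) _ i _)

/-! ### Nodes -/

/-- The nodes of a tree. -/
def Node : P.Tree D Y → Type w
  | leaf _ _ => PEmpty
  | node _ _ _ ch => Option (Σ i, (ch i).Node)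

/-- The operation at a node. -/
def op : (t : P.Tree D Y) → t.Node → P.Op
  | node o _ _ _, none => o
  | node _ _ _ ch, some v => (ch v.1).op v.2

/-- Relabel the nodes of a tree. -/
def relabel : (t : P.Tree D Y) → (f : t.Node → X') → (∀ v, D' (t.op v) (f v)) → P.Tree D' Y
  | leaf s y, _, _ => leaf s y
  | node o _ _ ch, f, hf => node o (f none) (hf none)
      (fun i => (ch i).relabel (fun v => f (some ⟨i, v⟩)) (fun v => hf (some ⟨i, v⟩)))

theorem relabel_root (t : P.Tree D Y) (f : t.Node → X') (hf : ∀ v, D' (t.op v) (f v)) :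
    (t.relabel f hf).root = t.root := by cases t <;> rfl

theorem relabel_WT (t : P.Tree D Y) (f : t.Node → X') (hf : ∀ v, D' (t.op v) (f v)) (h : t.WT) :
    (t.relabel f hf).WT := by
  induction t with
  | leaf => trivial
  | node o x hx ch ih => exact fun i => ⟨(relabel_root _ _ _).trans (h i).1, ih i _ _ (h i).2⟩

theorem relabel_flat (t : P.Tree D Y) (f : t.Node → X') (hf : ∀ v, D' (t.op v) (f v)) (h : t.WT) :
    ((t.relabel f hf).flat (relabel_WT t f hf h)).1 = (t.flat h).1 := by
  induction t with
  | leaf => rfl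
  | node o x hx ch ih => exact bind_congr (fun i => ih i _ _ (h i).2) _

theorem finite_node (t : P.Tree D Y) : Finite t.Node := by
  induction t with
  | leaf => exact inferInstanceAs (Finite PEmpty)
  | node o x hx ch ih =>
    have := P.finite_ar o
    exact inferInstanceAs (Finite (Option (Σ i, (ch i).Node)))

/-- The leaves of a tree. -/
def Leaf : P.Tree D Y → Type w
  | leaf _ _ => PUnit
  | node o _ _ ch => Σ i : P.Ar o, (ch i).Leaf

/-- The label of a leaf. -/
def ll : (t : P.Tree D Y) → t.Leaf → Y
  | leaf _ y, _ => y
  | node _ _ _ ch, l => (ch l.1).ll l.2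

/-- The nodes of `t.bindL u` are the nodes of `t` and those of the trees grafted on its leaves. -/
def bn : (t : P.Tree D Y) → (u : Y → P.Tree D Y') →
    (t.Node ⊕ Σ l : t.Leaf, (u (t.ll l)).Node) → (t.bindL u).Node
  | leaf _ _, _, .inr w => w.2
  | node _ _ _ _, _, .inl none => none
  | node _ _ _ ch, u, .inl (some v) => some ⟨v.1, (ch v.1).bn u (.inl v.2)⟩
  | node _ _ _ ch, u, .inr w => some ⟨w.1.1, (ch w.1.1).bn u (.inr ⟨w.1.2, w.2⟩)⟩

/-- The inverse of `bn`. -/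
def bnInv : (t : P.Tree D Y) → (u : Y → P.Tree D Y') →
    (t.bindL u).Node → (t.Node ⊕ Σ l : t.Leaf, (u (t.ll l)).Node)
  | leaf _ _, _, w => .inr ⟨PUnit.unit, w⟩
  | node _ _ _ _, _, none => .inl none
  | node _ _ _ ch, u, some v => ((ch v.1).bnInv u v.2).elim (fun x => .inl (some ⟨v.1, x⟩))
      (fun x => .inr ⟨⟨v.1, x.1⟩, x.2⟩)

theorem bnInv_bn (t : P.Tree D Y) (u : Y → P.Tree D Y') (x) : t.bnInv u (t.bn u x) = x := by
  induction t with
  | leaf s y =>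
    rcases x with x | ⟨l, x⟩
    · exact x.elim
    · rfl
  | node o x hx ch ih =>
    rcases x with (_ | v) | w
    · rfl
    · simp only [bn, bnInv, ih]; rfl
    · simp only [bn, bnInv, ih]; rfl

theorem bn_bnInv (t : P.Tree D Y) (u : Y → P.Tree D Y') (x) : t.bn u (t.bnInv u x) = x := by
  induction t with
  | leaf s y => rfl
  | node o x₀ hx ch ih =>
    rcases x with _ | ⟨i, v⟩
    · rfl
    · have := ih i v
      simp only [bnInv]
      generalize (ch i).bnInv u v = z at this
      subst this
      rcases z with z | z <;> rfl

/-- `bn` as an equivalence. -/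
def bnE (t : P.Tree D Y) (u : Y → P.Tree D Y') :
    (t.Node ⊕ Σ l : t.Leaf, (u (t.ll l)).Node) ≃ (t.bindL u).Node :=
  ⟨t.bn u, t.bnInv u, t.bnInv_bn u, t.bn_bnInv u⟩

theorem op_bn_inl (t : P.Tree D Y) (u : Y → P.Tree D Y') (v : t.Node) :
    (t.bindL u).op (t.bn u (.inl v)) = t.op v := by
  induction t with
  | leaf s y => exact v.elim
  | node o x hx ch ih =>
    rcases v with _ | ⟨i, v⟩
    · rfl
    · exact ih i v

theorem op_bn_inr (t : P.Tree D Y) (u : Y → P.Tree D Y') (l : t.Leaf) (v : (u (t.ll l)).Node) :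
    (t.bindL u).op (t.bn u (.inr ⟨l, v⟩)) = (u (t.ll l)).op v := by
  induction t with
  | leaf s y => rfl
  | node o x hx ch ih => exact ih l.1 l.2 v

/-- Relabelling the leaves does not change the nodes. -/
def labelNode : (t : P.Tree D Y) → (h : t.WT) → (f : P.Ar (t.shape h) → Y') →
    t.Node ≃ (t.label h f).Node
  | leaf _ _, _, _ => Equiv.refl _
  | node _ _ _ ch, h, _ =>
    Equiv.optionCongr (Equiv.sigmaCongrRight fun i => (ch i).labelNode (h i).2 _)

theorem op_labelNode (t : P.Tree D Y) (h : t.WT) (f : P.Ar (t.shape h) → Y') (v : t.Node) :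
    (t.label h f).op (t.labelNode h f v) = t.op v := by
  induction t with
  | leaf s y => exact v.elim
  | node o x hx ch ih =>
    rcases v with _ | ⟨i, v⟩
    · rfl
    · exact ih i _ _ v

/-- The leaves of a tree are the inputs of its composite. -/
def labelLeaf : (t : P.Tree D Y) → (h : t.WT) → (f : P.Ar (t.shape h) → Y') →
    (t.label h f).Leaf ≃ P.Ar (t.shape h)
  | leaf s _, _, _ => ⟨fun _ => P.pt s, fun _ => PUnit.unit, fun _ => rfl, fun p => (P.eq_pt s p).symm⟩
  | node _ _ _ ch, h, _ =>
    (Equiv.sigmaCongrRight fun i => (ch i).labelLeaf (h i).2 _).trans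
      (P.pos _ _ (fun i => ((ch i).flat (h i).2).2.trans (h i).1))

theorem ll_label (t : P.Tree D Y) (h : t.WT) (f : P.Ar (t.shape h) → Y') (l) :
    (t.label h f).ll l = f (t.labelLeaf h f l) := by
  induction t with
  | leaf s y => rfl
  | node o x hx ch ih => exact ih l.1 (h l.1).2 _ l.2

theorem castAr_bijective {a b : P.Op} (e : a = b) : Function.Bijective (P.castAr e) := by
  subst e; exact Function.bijective_id

/-- The leaves of a tree with composite `o` are the inputs of `o`. -/
noncomputable def leafEquiv {o : P.Op} (r : P.WTree D) (hr : r.shape = o) :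
    (r.tree.label r.wt (P.castAr hr)).Leaf ≃ P.Ar o :=
  Equiv.ofBijective (r.tree.label r.wt (P.castAr hr)).ll (by
    rw [funext (ll_label r.tree r.wt (P.castAr hr))]
    exact (castAr_bijective hr).comp (Equiv.bijective _))

/-- A sum over the nodes, split into the root and the other nodes. -/
def rootSplit {A : Type w} {B : Option A → Type w} : (Σ v, B v) ≃ B none ⊕ Σ a, B (some a) where
  toFun
    | ⟨none, b⟩ => .inl b
    | ⟨some a, b⟩ => .inr ⟨a, b⟩
  invFun
    | .inl b => ⟨none, b⟩
    | .inr ⟨a, b⟩ => ⟨some a, b⟩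
  left_inv := by rintro ⟨_ | a, b⟩ <;> rfl
  right_inv := by rintro (b | ⟨a, b⟩) <;> rfl

/-- The nodes of the result of a substitution are the nodes of the trees substituted. -/
noncomputable def joinNode : (t : P.Tree D' Y) → (ρ : t.Node → P.WTree D) →
    (h : ∀ v, P.Fits D (t.op v) (ρ v)) →
    (Σ v, (ρ v).tree.Node) ≃ (t.relabel (D' := P.Fits D) ρ h).join.Node
  | leaf _ _, _, _ => ⟨fun x => x.1.elim, fun x => x.elim, fun x => x.1.elim, fun x => x.elim⟩
  | node _ _ _ ch, ρ, h =>
    rootSplit.trans <|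
    (Equiv.sumCongr ((ρ none).tree.labelNode (ρ none).wt (P.castAr (h none)))
      ((Equiv.sigmaAssoc _).trans ((Equiv.sigmaCongrRight fun i =>
          (ch i).joinNode (fun v => ρ (some ⟨i, v⟩)) (fun v => h (some ⟨i, v⟩))).trans
        (Equiv.sigmaCongrLeft (leafEquiv (ρ none) (h none))).symm))).trans
    (bnE ((ρ none).tree.label (ρ none).wt (P.castAr (h none))) (fun i => ((ch i).relabel
      (D' := P.Fits D) (fun v => ρ (some ⟨i, v⟩)) (fun v => h (some ⟨i, v⟩))).join))

theorem node_congr {o : P.Op} {x x' : X} {hx : D o x} {hx' : D o x'} {ch ch' : P.Ar o → P.Tree D Y}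
    (e : x = x') (h : ∀ i, ch i = ch' i) : node o x hx ch = node o x' hx' ch' := by
  subst e
  obtain rfl : ch = ch' := funext h
  rfl

/-- The inclusion of the nodes of a grafted tree. -/
noncomputable def graftNode {o : P.Op} (r : P.WTree D) (hr : r.shape = o) (u : P.Ar o → P.Tree D Y)
    (i : P.Ar o) (z : (u i).Node) : ((r.tree.label r.wt (P.castAr hr)).bindL u).Node :=
  bn (r.tree.label r.wt (P.castAr hr)) u
    (.inr ((Equiv.sigmaCongrLeft (leafEquiv r hr) (β := fun i => (u i).Node)).symm ⟨i, z⟩))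

theorem graftNode_ll {o : P.Op} (r : P.WTree D) (hr : r.shape = o) (u : P.Ar o → P.Tree D Y)
    (l : (r.tree.label r.wt (P.castAr hr)).Leaf)
    (z : (u ((r.tree.label r.wt (P.castAr hr)).ll l)).Node) :
    graftNode r hr u ((r.tree.label r.wt (P.castAr hr)).ll l) z =
      bn (r.tree.label r.wt (P.castAr hr)) u (.inr ⟨l, z⟩) :=
  congrArg (fun x => bn _ u (.inr x)) ((Equiv.symm_apply_eq _).2 rfl)

theorem op_graftNode {o : P.Op} (r : P.WTree D) (hr : r.shape = o) (u : P.Ar o → P.Tree D Y)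
    (i : P.Ar o) (z : (u i).Node) :
    ((r.tree.label r.wt (P.castAr hr)).bindL u).op (graftNode r hr u i z) = (u i).op z := by
  obtain ⟨l, rfl⟩ := (leafEquiv r hr).surjective i
  exact (congrArg (Tree.op _) (graftNode_ll r hr u l z)).trans (op_bn_inr _ u l z)

theorem op_joinNode (t : P.Tree D' Y) (ρ : t.Node → P.WTree D)
    (h : ∀ v, P.Fits D (t.op v) (ρ v)) (v : t.Node) (x : (ρ v).tree.Node) :
    (t.relabel (D' := P.Fits D) ρ h).join.op (t.joinNode ρ h ⟨v, x⟩) = (ρ v).tree.op x := by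
  induction t with
  | leaf s y => exact v.elim
  | node o x₀ hx ch ih =>
    rcases v with _ | ⟨i, v⟩
    · exact (op_bn_inl _ _ _).trans (op_labelNode _ _ _ x)
    · refine Eq.trans ?_ (ih i (fun v => ρ (some ⟨i, v⟩)) (fun v => h (some ⟨i, v⟩)) v x)
      exact op_graftNode (ρ none) (h none) _ i _

theorem relabel_bindL (t : P.Tree D Y) (u : Y → P.Tree D Y') (u' : Y → P.Tree D' Y')
    (g : (t.bindL u).Node → X') (hg : ∀ v, D' ((t.bindL u).op v) (g v))
    (hu : ∀ l : t.Leaf, (u (t.ll l)).relabel (fun v => g (t.bn u (.inr ⟨l, v⟩)))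
      (fun v => op_bn_inr t u l v ▸ hg _) = u' (t.ll l)) :
    (t.bindL u).relabel g hg = (t.relabel (fun v => g (t.bn u (.inl v)))
      (fun v => op_bn_inl t u v ▸ hg _)).bindL u' := by
  induction t with
  | leaf s y => exact hu PUnit.unit
  | node o x hx ch ih =>
    simp only [bindL, relabel, bn]
    refine node_congr rfl fun i => ?_
    exact ih i (fun v => g (some ⟨i, v⟩)) (fun v => hg (some ⟨i, v⟩)) (fun l => hu ⟨i, l⟩)

theorem relabel_label_mapL (t : P.Tree D PUnit.{w+1}) (h : t.WT) (f : P.Ar (t.shape h) → Y')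
    (g : (t.label h f).Node → X') (hg : ∀ v, D' ((t.label h f).op v) (g v)) :
    ((t.label h f).relabel g hg).mapL (fun _ => PUnit.unit) =
      t.relabel (fun v => g (t.labelNode h f v)) (fun v => op_labelNode t h f v ▸ hg _) := by
  induction t with
  | leaf s y => rfl
  | node o x hx ch ih =>
    simp only [label, relabel, mapL]
    exact node_congr rfl fun i => ih i (h i).2 _ (fun v => g (some ⟨i, v⟩))
      (fun v => hg (some ⟨i, v⟩))

/-- Relabelling a well-typed tree. -/
def _root_.PolyMonad.WTree.relabel (r : P.WTree D) (f : r.tree.Node → X')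
    (hf : ∀ v, D' (r.tree.op v) (f v)) : P.WTree D' :=
  ⟨r.tree.relabel f hf, relabel_WT _ _ _ r.wt⟩

theorem _root_.PolyMonad.WTree.relabel_shape (r : P.WTree D) (f : r.tree.Node → X')
    (hf : ∀ v, D' (r.tree.op v) (f v)) : (r.relabel f hf).shape = r.shape :=
  congrArg Sigma.fst (relabel_flat r.tree f hf r.wt)

theorem relabel_label_cast {o : P.Op} (r : P.WTree D) (hr : r.shape = o)
    (g : (r.tree.label r.wt (P.castAr hr)).Node → X') (hg) :
    (r.tree.label r.wt (P.castAr hr)).relabel g hg =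
      (r.relabel (fun v => g (r.tree.labelNode r.wt _ v))
        (fun v => op_labelNode r.tree r.wt _ v ▸ hg _)).tree.label (D := D')
        (relabel_WT _ _ _ r.wt)
        (P.castAr ((r.relabel_shape _ _).trans hr)) := by
  refine eq_label _ (relabel_WT _ _ _ (label_WT _ _ _)) _ (relabel_WT _ _ _ r.wt) ?_ _ ?_
  · exact relabel_label_mapL r.tree r.wt _ g hg
  · rw [relabel_flat _ _ _ (label_WT _ _ _), flat_label]
    exact (castAr_lab hr).trans (castAr_lab ((r.relabel_shape _ _).trans hr)).symm

theorem relabel_join {X₀ : Type w} {D₀ : P.Op → X₀ → Prop} (t : P.Tree D₀ Y)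
    (ρ : t.Node → P.WTree D) (h : ∀ v, P.Fits D (t.op v) (ρ v))
    (g : (t.relabel (D' := P.Fits D) ρ h).join.Node → X')
    (hg : ∀ v, D' ((t.relabel (D' := P.Fits D) ρ h).join.op v) (g v)) :
    (t.relabel (D' := P.Fits D) ρ h).join.relabel g hg =
      (t.relabel (D' := P.Fits D')
        (fun v => (ρ v).relabel (fun x => g (t.joinNode ρ h ⟨v, x⟩))
          (fun x => op_joinNode t ρ h v x ▸ hg _))
        (fun v => ((ρ v).relabel_shape _ _).trans (h v))).join := by
  induction t with
  | leaf s y => rfl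
  | node o x₀ hx ch ih =>
    have key := fun i => ih i (fun v => ρ (some ⟨i, v⟩)) (fun v => h (some ⟨i, v⟩))
      (fun z => g (graftNode (ρ none) (h none) (fun i => ((ch i).relabel
        (D' := P.Fits D) (fun v => ρ (some ⟨i, v⟩)) (fun v => h (some ⟨i, v⟩))).join) i z))
      (fun z => by
        have := hg (graftNode (ρ none) (h none) (fun i => ((ch i).relabel
          (D' := P.Fits D) (fun v => ρ (some ⟨i, v⟩)) (fun v => h (some ⟨i, v⟩))).join) i z)
        exact op_graftNode (ρ none) (h none) (fun i => ((ch i).relabel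
          (D' := P.Fits D) (fun v => ρ (some ⟨i, v⟩)) (fun v => h (some ⟨i, v⟩))).join) i z ▸ this)
    simp only [relabel, join]
    refine (relabel_bindL _ _ (fun i => Tree.join (relabel _ _ _)) g hg ?_).trans
      (congrArg (fun z => bindL z _) (relabel_label_cast (ρ none) (h none) _ _))
    intro l
    refine Eq.trans ?_ (key _)
    congr 1
    funext z
    exact congrArg g (graftNode_ll (ρ none) (h none) (fun i => ((ch i).relabel
      (D' := P.Fits D) (fun v => ρ (some ⟨i, v⟩)) (fun v => h (some ⟨i, v⟩))).join) l z).symm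

theorem joinMap_relabel {X₀ : Type w} {D₀ : P.Op → X₀ → Prop} (t : P.Tree D₀ Y)
    (ρ : t.Node → P.WTree (P.Fits D)) (h : ∀ v, P.Fits (P.Fits D) (t.op v) (ρ v)) :
    (t.relabel (D' := P.Fits (P.Fits D)) ρ h).joinMap =
      t.relabel (D' := P.Fits D) (fun v => ⟨(ρ v).tree.join, join_WT _ (ρ v).wt⟩)
        (fun v => (shape_join (ρ v)).trans (h v)) := by
  induction t with
  | leaf => rfl
  | node o x hx ch ih => exact node_congr rfl fun i => ih i _ _

theorem relabel_corolla (t : P.Tree D Y) (f : t.Node → X') :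
    t.relabel (D' := P.Fits (fun (_ : P.Op) (_ : X') => True))
      (fun v => WTree.relabel (D := fun (_ : P.Op) (_ : PUnit.{w+1}) => True)
        ⟨corolla (t.op v) PUnit.unit trivial, corolla_WT _ _ _⟩ (fun _ => f v) (fun _ => trivial))
      (fun _ => (WTree.relabel_shape _ _ _).trans (corolla_shape _ _ _)) =
    (t.relabel (D' := fun _ _ => True) f (fun _ => trivial)).corollaMap := by
  induction t with
  | leaf => rfl
  | node o x hx ch ih => exact node_congr rfl fun i => ih i _

theorem relabel_inj {t t' : P.Tree (fun (_ : P.Op) (_ : PUnit.{w+1}) => True) Y} {f : t.Node → X'}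
    {f' : t'.Node → X'}
    (e : t.relabel (D' := fun _ _ => True) f (fun _ => trivial) =
      t'.relabel (D' := fun _ _ => True) f' (fun _ => trivial)) :
    (⟨t, f⟩ : Σ t : P.Tree (fun (_ : P.Op) (_ : PUnit.{w+1}) => True) Y, (t.Node → X')) =
      ⟨t', f'⟩ := by
  induction t generalizing t' with
  | leaf s y =>
    cases t' with
    | leaf s' y' =>
      simp only [relabel, leaf.injEq] at e
      obtain ⟨rfl, rfl⟩ := e
      congr 1
      funext v
      exact v.elim
    | node => simp [relabel] at e
  | node o x hx ch ih =>
    cases t' with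
    | leaf => simp [relabel] at e
    | node o' x' hx' ch' =>
      simp only [relabel, node.injEq] at e
      obtain ⟨rfl, e₁, e₂⟩ := e
      have key := fun i => ih i (congrFun (eq_of_heq e₂) i)
      obtain rfl : ch = ch' := funext fun i => congrArg Sigma.fst (key i)
      congr 1
      funext v
      rcases v with _ | ⟨i, v⟩
      · exact e₁
      · exact congrFun (eq_of_heq (Sigma.mk.inj (key i)).2) v

end Tree

/-- No restriction on labels, which are trivial. -/
abbrev Full : P.Op → PUnit.{w+1} → Prop := fun _ _ => True

/-- The data of the free `P`-operad monad, see `slice`. -/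
noncomputable def sliceData : PolyData.{w} where
  S := P.Op
  Op := P.WTree P.Full
  Ar r := r.tree.Node
  tgt r := r.shape
  src r v := r.tree.op v
  finite_ar r := r.tree.finite_node
  unit o := ⟨Tree.corolla o PUnit.unit trivial, Tree.corolla_WT _ _ _⟩
  tgt_unit o := Tree.corolla_shape _ _ _
  pt _ := none
  eq_pt := by
    rintro s (_ | ⟨i, v⟩)
    · rfl
    · exact v.elim
  src_unit _ := rfl
  sub r ρ h := ⟨(r.tree.relabel (D' := P.Fits P.Full) ρ h).join,
    Tree.join_WT _ (Tree.relabel_WT _ _ _ r.wt)⟩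
  tgt_sub r ρ h := congrArg Sigma.fst
    ((Tree.flat_join _ (Tree.relabel_WT _ _ _ r.wt)).trans (Tree.relabel_flat _ ρ h r.wt))
  pos r ρ h := r.tree.joinNode ρ h
  src_pos r ρ h v x := Tree.op_joinNode _ _ _ _ _

/-- No restriction on labels. -/
abbrev Any (X : Type w) : P.Op → X → Prop := fun _ _ => True

/-- A labelled operation of the slice is a tree with labelled nodes. -/
def toTree {X : Type w} (z : P.sliceData.Lab X) : P.WTree (P.Any X) :=
  WTree.relabel (P := P) z.1 z.2 (fun _ => trivial)

theorem toTree_inj {X : Type w} : Function.Injective (P.toTree (X := X)) := by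
  rintro ⟨⟨t, h⟩, f⟩ ⟨⟨t', h'⟩, f'⟩ e
  have := Tree.relabel_inj (congrArg WTree.tree e)
  obtain ⟨rfl, e'⟩ := Sigma.mk.inj this
  obtain rfl := eq_of_heq e'
  rfl

theorem toTree_shape {X : Type w} (z : P.sliceData.Lab X) :
    (P.toTree z).shape = WTree.shape (P := P) z.1 := WTree.relabel_shape _ _ _

theorem toTree_bind {X : Type w} (r : P.sliceData.Op) (ρ : P.sliceData.Ar r → P.sliceData.Lab X)
    (h : ∀ i, P.sliceData.tgt (ρ i).1 = P.sliceData.src r i) :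
    (P.toTree (P.sliceData.bind r ρ h)).tree =
      (Tree.relabel (D' := P.Fits (P.Any X)) (WTree.tree (P := P) r) (fun v => P.toTree (ρ v))
        (fun v => (P.toTree_shape _).trans (h v))).join := by
  refine (Tree.relabel_join _ (fun v => (ρ v).1) h _ _).trans ?_
  congr 1
  congr 1
  funext v
  unfold toTree
  congr 1
  funext x
  exact P.sliceData.bind_snd_pos r ρ h v x

/-- The free operad construction. Let `T` be the monad on `Set/S` given by `P`. The object `T 1` of
`Set/S` is the set `Op` of operations with the map `tgt`, so a `T`-graph on `1`, that is, a span
`T 1 ← X → 1` in `Set/S`, is the same thing as a set over `Op`. The free `T`-operad on a `T`-graph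
`X` has as its arrows the formal expressions generated by
* a formal identity for each colour `s`, lying over `unit s`;
* for `x` in `X` over an operation `o`, and formal expressions over `ρ i` for the inputs `i` of
  `o`, with matching colours, a formal expression lying over `sub o ρ`;

in other words, well-typed trees of operations of `P` whose nodes are labelled by elements of `X`
lying over the operation at the node; such a tree lies over its composite. So the free `T`-operad
monad on `T`-graphs on `1` is again polynomial: its set of colours is `Op`, its operations are the
well-typed trees, the inputs of a tree are its nodes, the colour of an input is the operation at
that node, and the colour of the output is the composite of the tree. The unit is given by
one-node trees and composition by substituting trees for nodes. -/
noncomputable def slice : PolyMonad.{w} where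
  toPolyData := P.sliceData
  bind_unit_left X o ρ h := by
    refine P.toTree_inj (WTree.ext ?_)
    rw [toTree_bind]
    exact Tree.join_corolla o (P.toTree (ρ none)) _
  bind_unit_right X r f h := by
    refine P.toTree_inj (WTree.ext ?_)
    rw [toTree_bind]
    refine Eq.trans ?_ (Tree.join_corollaMap (P.toTree ⟨r, f⟩).tree)
    congr 1
    exact Tree.relabel_corolla _ _
  bind_assoc X r ρ h ρ' h' := by
    refine P.toTree_inj (WTree.ext ?_)
    refine (P.toTree_bind _ _ _).trans (Eq.trans ?_ (P.toTree_bind _ _ _).symm)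
    refine (congrArg Tree.join (Tree.relabel_join _ ρ h _ _)).trans ?_
    refine (Tree.join_join _).trans (congrArg Tree.join ?_)
    refine (Tree.joinMap_relabel _ _ _).trans ?_
    congr 1
    funext v
    exact WTree.ext (P.toTree_bind _ _ _).symm

end PolyMonad
/-- The identity monad on `Set = Set/1`, as a polynomial monad. -/
def PolyMonad.idMonad : PolyMonad.{w} where
  S := PUnit
  Op := PUnit
  Ar _ := PUnit
  tgt _ := PUnit.unit
  src _ _ := PUnit.unit
  finite_ar _ := inferInstance
  unit _ := PUnit.unit
  tgt_unit _ := rfl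
  pt _ := PUnit.unit
  eq_pt _ _ := rfl
  src_unit _ := rfl
  sub _ _ _ := PUnit.unit
  tgt_sub _ _ _ := rfl
  pos _ _ _ := ⟨fun _ => PUnit.unit, fun _ => ⟨PUnit.unit, PUnit.unit⟩, fun _ => rfl, fun _ => rfl⟩
  src_pos _ _ _ _ _ := rfl
  bind_unit_left _ _ _ _ := rfl
  bind_unit_right _ _ _ _ := rfl
  bind_assoc _ _ _ _ _ _ := rfl

/-- The opetopic sequence: `(opetopic n).S` is the set `S_n` of `n`-opetopes, and
`(opetopic n).monad` (below) is the monad `T_n` on `Set/S_n`. It starts from the identity monad on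
`Set`, and `T_{n+1}` is the free `T_n`-operad monad on the category of `T_n`-graphs on `1`, which
is `Set/S_{n+1}` for `S_{n+1}` the set of operations of `T_n` (the underlying set of `T_n 1`). -/
noncomputable def opetopic : ℕ → PolyMonad.{w}
  | 0 => PolyMonad.idMonad
  | n + 1 => (opetopic n).slice

/-! ## 2. The monad on `Set/S` and the comparison with multisets -/

open CategoryTheory Limits

namespace PolyMonad

variable (P : PolyMonad.{w})

/-- For `X` over `S`, the elements of `T X`: an operation whose inputs are labelled by elements of
`X`, of matching colours. -/
structure Diag (X : Over P.S) : Type w where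
  lab : P.Lab X.left
  typed : ∀ i, X.hom (lab.2 i) = P.src lab.1 i

variable {P} in
theorem Diag.ext' {X : Over P.S} {z z' : P.Diag X} (h : z.lab = z'.lab) : z = z' := by
  cases z; cases z'; cases h; rfl

/-- The object `T X` of `Set/S`. -/
def extObj (X : Over P.S) : Over P.S :=
  Over.mk (Y := P.Diag X) (↾fun z => P.tgt z.lab.1)

theorem left_hom {X Y : Over P.S} (f : X ⟶ Y) (x : X.left) : Y.hom (f.left x) = X.hom x :=
  congrArg (fun g => g x) (Over.w f)

/-- The functor `T` on morphisms: apply the morphism to all labels. -/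
def extMap {X Y : Over P.S} (f : X ⟶ Y) : P.extObj X ⟶ P.extObj Y :=
  Over.homMk (↾fun z : P.Diag X => (⟨⟨z.lab.1, fun i => f.left (z.lab.2 i)⟩,
    fun i => (P.left_hom f _).trans (z.typed i)⟩ : P.Diag Y)) rfl

/-- The functor `T`. -/
def extFunctor : Over P.S ⥤ Over P.S where
  obj := P.extObj
  map := P.extMap
  map_id _ := rfl
  map_comp _ _ := rfl

/-- The unit of `T`: a unit operation, labelled by the given element. -/
def extUnit : 𝟭 (Over P.S) ⟶ P.extFunctor where
  app X := Over.homMk (↾fun x : X.left => (⟨⟨P.unit (X.hom x), fun _ => x⟩, fun i => by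
    rw [P.eq_pt _ i]; exact (P.src_unit _).symm⟩ : P.Diag X)) (by
      ext x; exact P.tgt_unit _)
  naturality X Y f := by
    ext x
    refine Diag.ext' ?_
    change (⟨P.unit (Y.hom (f.left x)), fun _ => f.left x⟩ : P.Lab Y.left) =
      ⟨P.unit (X.hom x), fun _ => f.left x⟩
    rw [left_hom]

theorem bind_typed {X : Over P.S} (o : P.Op) (ρ : P.Ar o → P.Lab X.left)
    (h : ∀ i, P.tgt (ρ i).1 = P.src o i) (hρ : ∀ i q, X.hom ((ρ i).2 q) = P.src (ρ i).1 q)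
    (p : P.Ar (P.bind o ρ h).1) : X.hom ((P.bind o ρ h).2 p) = P.src (P.bind o ρ h).1 p := by
  obtain ⟨⟨i, q⟩, rfl⟩ := (P.pos o (fun i => (ρ i).1) h).surjective p
  rw [P.bind_snd_pos, hρ]
  exact (P.src_pos o (fun i => (ρ i).1) h i q).symm

/-- The multiplication of `T`: composition of labelled operations. -/
def extMul : P.extFunctor ⋙ P.extFunctor ⟶ P.extFunctor where
  app X := Over.homMk (↾fun z : P.Diag (P.extObj X) =>
    (⟨P.bind z.lab.1 (fun i => Diag.lab (P := P) (X := X) (z.lab.2 i)) z.typed,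
      P.bind_typed _ _ _ fun i => Diag.typed (P := P) (X := X) (z.lab.2 i)⟩ : P.Diag X)) (by
      ext z; exact P.tgt_sub _ _ _)
  naturality X Y f := rfl

/-- The monad `T` on `Set/S` given by a polynomial monad. -/
def monad : Monad (Over P.S) where
  toFunctor := P.extFunctor
  η := P.extUnit
  μ := P.extMul
  left_unit X := by
    ext z
    exact Diag.ext' (P.bind_unit_left _ _ (fun _ => Diag.lab (P := P) (X := X) z) _)
  right_unit X := by
    ext z
    refine Diag.ext' ?_
    have key : ∀ (g : ∀ i : P.Ar z.lab.1, P.S) (hg : ∀ i, g i = P.src z.lab.1 i)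
        (h : ∀ i, P.tgt (P.unit (g i)) = P.src z.lab.1 i),
        P.bind z.lab.1 (fun i => ⟨P.unit (g i), fun _ => z.lab.2 i⟩) h = z.lab := by
      intro g hg h
      obtain rfl : g = P.src z.lab.1 := funext hg
      exact P.bind_unit_right _ _ _ _
    exact key _ z.typed _
  assoc X := by
    ext z
    refine Diag.ext' (Eq.symm ?_)
    refine (P.bind_assoc _ z.lab.1 (fun i => (Diag.lab (P := P) (X := P.extObj X) (z.lab.2 i)).1)
      _ _ _).trans ?_
    refine Tree.bind_congr (fun i => ?_) _
    refine Tree.bind_congr (fun q => ?_) _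
    exact congrArg (Diag.lab (P := P) (X := X))
      (P.bind_snd_pos z.lab.1 (fun i => (Diag.lab (P := P) (X := P.extObj X) (z.lab.2 i))) _ i q)

/-- The inputs of an operation, each taken once. -/
noncomputable def positions (o : P.Op) : Multiset (P.Ar o) :=
  (@Finset.univ _ (@Fintype.ofFinite _ (P.finite_ar o))).val

/-- The natural transformation `θ : U T ⟶ M U`, where `U : Set/S ⥤ Set` is the forgetful functor and
`M` is the free commutative monoid functor (finite multisets): it sends an operation with labelled
inputs to the multiset of the labels. -/
noncomputable def theta : P.monad.toFunctor ⋙ Over.forget P.S ⟶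
    Over.forget P.S ⋙ (ofTypeMonad.{w} Multiset).toFunctor where
  app X := ↾fun z : P.Diag X => (P.positions z.lab.1).map z.lab.2
  naturality X Y f := by
    ext z
    exact (Multiset.map_map f.left z.lab.2 (P.positions z.lab.1)).symm

end PolyMonad


/-! ## 3. Monad opfunctors and multicategories -/

/-- `(U, θ)` is a monad opfunctor from `(C, T)` to `(D, M)`: `θ : U T ⟶ M U` is compatible with the
units and the multiplications of the monads. -/
structure IsMonadOpfunctor {C : Type*} [Category* C] {D : Type*} [Category* D]
    (T : Monad C) (M : Monad D) (U : C ⥤ D) (θ : T.toFunctor ⋙ U ⟶ U ⋙ M.toFunctor) : Prop where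
  unit : ∀ X, U.map (T.η.app X) ≫ θ.app X = M.η.app (U.obj X)
  mul : ∀ X, U.map (T.μ.app X) ≫ θ.app X =
    θ.app (T.obj X) ≫ M.map (θ.app X) ≫ M.μ.app (U.obj X)

section Multicategories

variable {E : Type u} [Category.{v} E] [HasPullbacks E]

/-- A `T`-graph `T C₀ ← C₁ → C₀` (here `ob` is `C₀` and `arr` is `C₁`) with morphisms
`ids : C₀ ⟶ C₁` and `comp : C₁ ∘ C₁ ⟶ C₁`, where `C₁ ∘ C₁` is the pullback of `T C₁ ⟶ T C₀ ⟵ C₁`. -/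
structure MultData (T : Monad E) where
  ob : E
  arr : E
  dom : arr ⟶ T.obj ob
  cod : arr ⟶ ob
  ids : ob ⟶ arr
  comp : pullback (T.map cod) dom ⟶ arr

namespace MultData

variable {T : Monad E}

/-- The data form a `T`-multicategory, that is, a monad in the bicategory of `T`-spans: identities
and composites have the correct domains and codomains (those of the composite span `C₁ ∘ C₁`
being given by the multiplication of `T`), and the identity and associativity axioms hold. In the
last axiom both sides are morphisms from `T (C₁ ∘ C₁) ×_{T C₀} C₁` to `C₁`. -/
structure IsMulticategory (C : MultData T) : Prop where
  ids_dom : C.ids ≫ C.dom = T.η.app C.ob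
  ids_cod : C.ids ≫ C.cod = 𝟙 C.ob
  comp_dom : C.comp ≫ C.dom = pullback.fst (T.map C.cod) C.dom ≫ T.map C.dom ≫ T.μ.app C.ob
  comp_cod : C.comp ≫ C.cod = pullback.snd (T.map C.cod) C.dom ≫ C.cod
  comp_ids : pullback.lift (C.dom ≫ T.map C.ids) (𝟙 C.arr)
      (by rw [Category.assoc, ← T.map_comp, ids_cod, T.map_id, Category.comp_id, Category.id_comp])
        ≫ C.comp = 𝟙 C.arr
  ids_comp : pullback.lift (T.η.app C.arr) (C.cod ≫ C.ids)
      (by rw [Category.assoc, ids_dom]; exact (T.η.naturality C.cod).symm) ≫ C.comp = 𝟙 C.arr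
  assoc :
    pullback.lift
      (pullback.fst (T.map (C.comp ≫ C.cod)) C.dom ≫ T.map C.comp)
      (pullback.snd (T.map (C.comp ≫ C.cod)) C.dom)
      (by rw [Category.assoc, ← T.map_comp, pullback.condition]) ≫ C.comp =
    pullback.lift
      (pullback.fst (T.map (C.comp ≫ C.cod)) C.dom ≫
        T.map (pullback.fst (T.map C.cod) C.dom) ≫ T.μ.app C.arr)
      (pullback.lift
        (pullback.fst (T.map (C.comp ≫ C.cod)) C.dom ≫ T.map (pullback.snd (T.map C.cod) C.dom))
        (pullback.snd (T.map (C.comp ≫ C.cod)) C.dom)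
        (by rw [Category.assoc, ← T.map_comp, ← comp_cod, pullback.condition]) ≫ C.comp)
      (by
        have hμ := T.μ.naturality C.cod
        simp only [Functor.comp_map] at hμ
        rw [Category.assoc, Category.assoc, Category.assoc, comp_dom, pullback.lift_fst_assoc,
          Category.assoc]
        change _ ≫ _ ≫ T.μ.app C.arr ≫ T.toFunctor.map C.cod = _
        rw [← hμ]
        simp only [← T.map_comp_assoc, pullback.condition]) ≫ C.comp

/-- Maps (functors) of `T`-multicategories. Such a map is an isomorphism exactly when `onOb` and
`onArr` are isomorphisms. -/
structure Hom (C D : MultData T) where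
  onOb : C.ob ⟶ D.ob
  onArr : C.arr ⟶ D.arr
  dom : onArr ≫ D.dom = C.dom ≫ T.map onOb
  cod : onArr ≫ D.cod = C.cod ≫ onOb
  ids : C.ids ≫ onArr = onOb ≫ D.ids
  comp : C.comp ≫ onArr =
    pullback.lift (pullback.fst (T.map C.cod) C.dom ≫ T.map onArr)
      (pullback.snd (T.map C.cod) C.dom ≫ onArr)
      (by rw [Category.assoc, Category.assoc, ← T.map_comp, cod, dom, T.map_comp,
            pullback.condition_assoc]) ≫ D.comp

end MultData

end Multicategories

/-! ## 4. Tensor products of finite families -/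

/-- Bracketed words, possibly with units, in the letters `L`. -/
inductive Word (L : Type w) : Type w
  | of (l : L) : Word L
  | one : Word L
  | tensor (a b : Word L) : Word L

namespace Word

variable {L : Type w} {L' : Type v}

/-- The letters of a word, with multiplicities. -/
def letters : Word L → Multiset L
  | of l => {l}
  | one => 0
  | tensor a b => a.letters + b.letters

/-- Substitution of words for letters. -/
def bind : Word L → (L → Word L') → Word L'
  | of l, ρ => ρ l
  | one, _ => one
  | tensor a b, ρ => tensor (a.bind ρ) (b.bind ρ)

/-- Replace each letter. -/
def map (e : L → L') (a : Word L) : Word L' := a.bind fun l => of (e l)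

theorem letters_bind (a : Word L) (ρ : L → Word L') :
    (a.bind ρ).letters = a.letters.bind fun l => (ρ l).letters := by
  induction a with
  | of l => simp [bind, letters]
  | one => rfl
  | tensor a b iha ihb => simp [bind, letters, iha, ihb]

theorem letters_map (a : Word L) (e : L → L') : (a.map e).letters = a.letters.map e := by
  rw [map, letters_bind]
  exact Multiset.bind_singleton _ _

/-- Formal composites and tensor products of structure morphisms (associativity, unit and symmetry
isomorphisms) of a symmetric monoidal category. -/
inductive Coh : Word L → Word L → Type w
  | id (a : Word L) : Coh a a
  | comp {a b c : Word L} (f : Coh a b) (g : Coh b c) : Coh a c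
  | tensor {a a' b b' : Word L} (f : Coh a a') (g : Coh b b') : Coh (a.tensor b) (a'.tensor b')
  | assoc (a b c : Word L) : Coh ((a.tensor b).tensor c) (a.tensor (b.tensor c))
  | assocInv (a b c : Word L) : Coh (a.tensor (b.tensor c)) ((a.tensor b).tensor c)
  | left (a : Word L) : Coh (one.tensor a) a
  | leftInv (a : Word L) : Coh a (one.tensor a)
  | right (a : Word L) : Coh (a.tensor one) a
  | rightInv (a : Word L) : Coh a (a.tensor one)
  | braid (a b : Word L) : Coh (a.tensor b) (b.tensor a)

/-- Right-bracketed word of a list. -/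
def ofList : List L → Word L
  | [] => one
  | l :: ls => tensor (of l) (ofList ls)

theorem coh_ofList_append (l l' : List L) :
    Nonempty (Coh ((ofList l).tensor (ofList l')) (ofList (l ++ l'))) ∧
      Nonempty (Coh (ofList (l ++ l')) ((ofList l).tensor (ofList l'))) := by
  induction l with
  | nil => exact ⟨⟨.left _⟩, ⟨.leftInv _⟩⟩
  | cons a l ih =>
    obtain ⟨⟨f⟩, ⟨g⟩⟩ := ih
    exact ⟨⟨(Coh.assoc _ _ _).comp ((Coh.id _).tensor f)⟩,
      ⟨((Coh.id _).tensor g).comp (Coh.assocInv _ _ _)⟩⟩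

theorem exists_coh_ofList (a : Word L) : ∃ l : List L, (l : Multiset L) = a.letters ∧
    Nonempty (Coh a (ofList l)) ∧ Nonempty (Coh (ofList l) a) := by
  induction a with
  | of l => exact ⟨[l], rfl, ⟨.rightInv _⟩, ⟨.right _⟩⟩
  | one => exact ⟨[], rfl, ⟨.id _⟩, ⟨.id _⟩⟩
  | tensor a b iha ihb =>
    obtain ⟨l, hl, ⟨f⟩, ⟨g⟩⟩ := iha
    obtain ⟨l', hl', ⟨f'⟩, ⟨g'⟩⟩ := ihb
    obtain ⟨⟨p⟩, ⟨q⟩⟩ := coh_ofList_append l l'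
    exact ⟨l ++ l', by simp [letters, ← hl, ← hl'], ⟨(f.tensor f').comp p⟩, ⟨q.comp (g.tensor g')⟩⟩

theorem coh_of_perm {l l' : List L} (h : l.Perm l') : Nonempty (Coh (ofList l) (ofList l')) := by
  induction h with
  | nil => exact ⟨.id _⟩
  | cons a _ ih => obtain ⟨f⟩ := ih; exact ⟨(Coh.id _).tensor f⟩
  | swap a b l =>
    exact ⟨(Coh.assocInv _ _ _).comp (((Coh.braid _ _).tensor (.id _)).comp (Coh.assoc _ _ _))⟩
  | trans _ _ ih ih' => obtain ⟨f⟩ := ih; obtain ⟨g⟩ := ih'; exact ⟨f.comp g⟩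

theorem nonempty_coh (a b : Word L) (h : a.letters = b.letters) : Nonempty (Coh a b) := by
  obtain ⟨l, hl, ⟨f⟩, -⟩ := exists_coh_ofList a
  obtain ⟨l', hl', -, ⟨g⟩⟩ := exists_coh_ofList b
  obtain ⟨p⟩ := coh_of_perm (Multiset.coe_eq_coe.1 (hl.trans (h.trans hl'.symm)))
  exact ⟨f.comp (p.comp g)⟩

variable {W : Type u} [Category.{v} W] [MonoidalCategory W]

open MonoidalCategory

/-- The tensor product of the objects `f l`, in the order and with the bracketing of the word. -/
def eval (f : L → W) : Word L → W
  | of l => f l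
  | one => 𝟙_ W
  | tensor a b => a.eval f ⊗ b.eval f

/-- The interpretation of a formal composite of structure morphisms. -/
def Coh.eval [BraidedCategory W] (f : L → W) : {a b : Word L} → Coh a b → (a.eval f ⟶ b.eval f)
  | _, _, .id _ => 𝟙 _
  | _, _, .comp p q => p.eval f ≫ q.eval f
  | _, _, .tensor p q => p.eval f ⊗ₘ q.eval f
  | _, _, .assoc _ _ _ => (α_ _ _ _).hom
  | _, _, .assocInv _ _ _ => (α_ _ _ _).inv
  | _, _, .left _ => (λ_ _).hom
  | _, _, .leftInv _ => (λ_ _).inv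
  | _, _, .right _ => (ρ_ _).hom
  | _, _, .rightInv _ => (ρ_ _).inv
  | _, _, .braid _ _ => (β_ _ _).hom

/-- A structural isomorphism between the tensor products given by two words with the same letters.
It is used only for words in which every letter occurs exactly once; then all formal composites
from `a` to `b` have the same interpretation, by coherence for symmetric monoidal categories. -/
noncomputable def canon [SymmetricCategory W] (f : L → W) (a b : Word L)
    (h : a.letters = b.letters) : a.eval f ⟶ b.eval f :=
  Coh.eval f (nonempty_coh a b h).some

/-- The tensor product, in the shape of the word `a`, of a family of morphisms whose sources are
themselves given as tensor products. -/
def evalBind {L' : Type*} {f : L' → W} {g : L → W} : (a : Word L) → (ρ : L → Word L') →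
    (∀ l, (ρ l).eval f ⟶ g l) → ((a.bind ρ).eval f ⟶ a.eval g)
  | of l, _, k => k l
  | one, _, _ => 𝟙 _
  | tensor a b, ρ, k => a.evalBind ρ k ⊗ₘ b.evalBind ρ k

end Word

/-! ## 5. The multicategory of a symmetric monoidal category -/

namespace PolyMonad

theorem positions_unit (P : PolyMonad.{w}) (s : P.S) : P.positions (P.unit s) = {P.pt s} := by
  let _ := @Fintype.ofFinite _ (P.finite_ar (P.unit s))
  have : (Finset.univ : Finset (P.Ar (P.unit s))) = {P.pt s} :=
    Finset.ext fun x => by simpa using P.eq_pt s x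
  exact congrArg Finset.val this

theorem positions_sub (P : PolyMonad.{w}) (o : P.Op) (ρ : P.Ar o → P.Op) (h) :
    P.positions (P.sub o ρ h) =
      (P.positions o).bind fun i => (P.positions (ρ i)).map fun q => P.pos o ρ h ⟨i, q⟩ := by
  let _ := @Fintype.ofFinite _ (P.finite_ar o)
  let _ := fun i => @Fintype.ofFinite _ (P.finite_ar (ρ i))
  let _ := @Fintype.ofFinite _ (P.finite_ar (P.sub o ρ h))
  have e : (Finset.univ : Finset (Σ i, P.Ar (ρ i))).val.map (P.pos o ρ h) =
      (Finset.univ : Finset (P.Ar (P.sub o ρ h))).val := by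
    rw [← Finset.map_univ_equiv (P.pos o ρ h)]; rfl
  refine e.symm.trans ?_
  change Multiset.map _ (Multiset.sigma _ _) = _
  simp only [Multiset.sigma, Multiset.map_bind, Multiset.map_map]
  rfl


section Smc

variable (P : PolyMonad.{max u v}) (W : Type u) [Category.{v} W] [MonoidalCategory W]

/-- A choice of tensor products in `W`:
* `tensor` is a function from finite multisets of objects of `W` to objects of `W`, which takes a
  multiset of objects and tensors them in some order (and with some bracketing);
* `word` records, for each operation `o` with inputs labelled by objects of `W`, in which order and
  bracketing the inputs of `o` are tensored to give the object chosen for the multiset of labels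
  (this has to be recorded since an object can occur several times in the multiset). -/
structure TensorChoice where
  tensor : Multiset W → W
  tensor_spec : ∀ m, ∃ a : Word W, a.letters = m ∧ a.eval (fun x => x) = tensor m
  word : (o : P.Op) → (P.Ar o → W) → Word (P.Ar o)
  word_letters : ∀ o f, (word o f).letters = P.positions o
  word_eval : ∀ o f, (word o f).eval f = tensor ((P.positions o).map f)

/-- The object `W₀ × S ⟶ S` of `Set/S`, where `W₀` is the set of objects of `W`. -/
def smcOb : Over P.S := Over.mk (Y := W × P.S) (↾Prod.snd)

variable {P W}

namespace TensorChoice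

variable (c c' : P.TensorChoice W)

/-- The tensor product of a diagram `t ∈ T (W₀ × S)` of objects of `W`: the composite of
`θ : T (W₀ × S) → M (W₀ × S)`, the projection to `M W₀`, and the function `M W₀ → W₀` chosen. -/
noncomputable def src (t : P.Diag (P.smcOb W)) : W :=
  c.tensor ((P.theta.app (P.smcOb W) t : Multiset (W × P.S)).map Prod.fst)

/-- The word in the inputs of `t` which gives the tensor product of `t`. -/
def srcWord (t : P.Diag (P.smcOb W)) : Word (P.Ar t.lab.1) :=
  c.word t.lab.1 (fun i => (t.lab.2 i).1)

theorem eval_srcWord (t : P.Diag (P.smcOb W)) :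
    (c.srcWord t).eval (fun i => (t.lab.2 i).1) = c.src t :=
  (c.word_eval _ _).trans (congrArg c.tensor
    (Multiset.map_map Prod.fst t.lab.2 (P.positions t.lab.1)).symm)

/-- An arrow from a diagram `t ∈ T (W₀ × S)` to an object is a morphism in `W` from the tensor
product of `t` to this object. -/
structure Arr where
  dom : P.Diag (P.smcOb W)
  cod : W
  hom : c.src dom ⟶ cod

/-- The arrows, as an object of `Set/S`. -/
def arr : Over P.S := Over.mk (Y := c.Arr) (↾fun k => P.tgt k.dom.lab.1)

/-- The domain of an arrow. -/
def arrDom : c.arr ⟶ P.monad.obj (P.smcOb W) := Over.homMk (↾fun k : c.Arr => k.dom) rfl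

/-- The codomain of an arrow; it has the same colour as the domain. -/
def arrCod : c.arr ⟶ P.smcOb W :=
  Over.homMk (↾fun k : c.Arr => (k.cod, P.tgt k.dom.lab.1)) rfl

variable [SymmetricCategory W]

/-- The identity arrow on `x`: the structural isomorphism from the tensor product of the one-object
diagram given by `x` to `x`. -/
noncomputable def idArr (x : W × P.S) : c.Arr where
  dom := (P.monad.η.app (P.smcOb W)).left x
  cod := x.1
  hom := eqToHom (c.eval_srcWord _).symm ≫
    Word.canon (fun _ => x.1) (c.srcWord ((P.monad.η.app (P.smcOb W)).left x)) (.of (P.pt x.2))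
      ((c.word_letters _ _).trans (P.positions_unit _))

/-- The identities, as a morphism of `Set/S`. -/
noncomputable def ids : P.smcOb W ⟶ c.arr :=
  Over.homMk (↾c.idArr) (Over.w (P.monad.η.app (P.smcOb W)))

/-- For a diagram `z` of arrows `k i`, the structural isomorphism from the tensor product of the
composite of all their domains to the tensor product of the tensor products of the domains,
followed by the tensor product of the morphisms `k i`. -/
noncomputable def tensorArr (z : P.Diag c.arr) :
    c.src ((P.monad.map c.arrDom ≫ P.monad.μ.app (P.smcOb W)).left z) ⟶
      c.src ((P.monad.map c.arrCod).left z) :=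
  let k : P.Ar z.lab.1 → c.Arr := z.lab.2
  let t : P.Diag (P.smcOb W) := (P.monad.map c.arrDom ≫ P.monad.μ.app (P.smcOb W)).left z
  let f : P.Ar t.lab.1 → W := fun p => (t.lab.2 p).1
  let e := P.pos z.lab.1 (fun i => (k i).dom.lab.1) z.typed
  let ρ : P.Ar z.lab.1 → Word (P.Ar t.lab.1) := fun i =>
    (c.srcWord (k i).dom).map fun q => e ⟨i, q⟩
  let a : Word (P.Ar z.lab.1) := c.srcWord ((P.monad.map c.arrCod).left z)
  eqToHom (c.eval_srcWord t).symm ≫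
  Word.canon f (c.srcWord t) (a.bind ρ) (by
    rw [Word.letters_bind]
    refine (c.word_letters _ _).trans ((P.positions_sub _ _ _).trans ?_)
    change _ = a.letters.bind _
    rw [show a.letters = P.positions z.lab.1 from c.word_letters _ _]
    refine Multiset.bind_congr fun i _ => ?_
    exact ((Word.letters_map _ _).trans (congrArg _ (c.word_letters _ _))).symm) ≫
  a.evalBind ρ (fun i =>
    (c.srcWord (k i).dom).evalBind (fun q => .of (e ⟨i, q⟩)) (fun q => eqToHom (congrArg Prod.fst
      (P.bind_snd_pos z.lab.1 (fun i => (k i).dom.lab) z.typed i q))) ≫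
    eqToHom (c.eval_srcWord (k i).dom) ≫ (k i).hom) ≫
  eqToHom (c.eval_srcWord ((P.monad.map c.arrCod).left z))

/-- The composite of a diagram `z` of arrows with an arrow `g` whose domain is the diagram of
codomains of `z`. -/
noncomputable def compArr (z : P.Diag c.arr) (g : c.Arr)
    (h : (P.monad.map c.arrCod).left z = g.dom) : c.Arr where
  dom := (P.monad.map c.arrDom ≫ P.monad.μ.app (P.smcOb W)).left z
  cod := g.cod
  hom := c.tensorArr z ≫ eqToHom (congrArg c.src h) ≫ g.hom

/-- The composition, as a morphism of `Set/S`. -/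
noncomputable def comp : pullback (P.monad.map c.arrCod) c.arrDom ⟶ c.arr :=
  Over.homMk (↾fun z => c.compArr ((pullback.fst (P.monad.map c.arrCod) c.arrDom).left z)
    ((pullback.snd (P.monad.map c.arrCod) c.arrDom).left z)
    (congrArg (fun g : pullback (P.monad.map c.arrCod) c.arrDom ⟶ P.monad.obj (P.smcOb W) =>
      g.left z) pullback.condition))
    (Over.w (pullback.fst (P.monad.map c.arrCod) c.arrDom ≫
        P.monad.map c.arrDom ≫ P.monad.μ.app (P.smcOb W)))

/-- The `T`-multicategory (data) associated to a symmetric monoidal category, for a given choice of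
tensor products. -/
noncomputable def multicat : MultData P.monad where
  ob := P.smcOb W
  arr := c.arr
  dom := c.arrDom
  cod := c.arrCod
  ids := c.ids
  comp := c.comp

/-- The comparison between two choices of tensor products: compose a morphism with the structural
isomorphism between the two tensor products of its domain. -/
noncomputable def changeArr (k : c.Arr) : c'.Arr where
  dom := k.dom
  cod := k.cod
  hom := eqToHom (c'.eval_srcWord k.dom).symm ≫
    Word.canon _ (c'.srcWord k.dom) (c.srcWord k.dom)
      ((c'.word_letters _ _).trans (c.word_letters _ _).symm) ≫
    eqToHom (c.eval_srcWord k.dom) ≫ k.hom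

/-- The comparison, as a morphism of `Set/S`. -/
noncomputable def change : c.arr ⟶ c'.arr := Over.homMk (↾c.changeArr c') rfl

end TensorChoice

end Smc

end PolyMonad

/-! The opetopic sequence enters only through the fact that every `opetopic n` is a finitary
polynomial monad; all statements are proved for an arbitrary `P : PolyMonad`. A unit operation has
one input, and the inputs of a composite are pairs of an input and an input of the operation put
there (`positions_unit`, `positions_sub`). Hence multisets of labels respect units and
multiplications, which is the opfunctor property. A word in objects of `W` lifts to a word in
positions by splitting the multiset of positions at each tensor (`Word.exists_eval_eq`), which
yields tensor choices.

The laws of the multicategory, and its independence of the choice, are instances of coherence: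
between words without repeated letters, parallel composites of structure morphisms are equal
(`Coh.eval_unique`). The proof of coherence is semantic. The functor `⊗ : W × W ⥤ W` is strong
symmetric monoidal, so equality at the families `f` and `g` gives equality at the family `f l ⊗ g
l`. A family on a finite set of letters thus decomposes into families which are trivial away from
one letter. For such a family every word has a unique evident isomorphism to the unit or to the
remaining object; structure morphisms commute with these isomorphisms, which can then be cancelled.

Coherence is applied through `CohEquiv`, the relation of differing by some structural isomorphism.
It is stable under composition, tensoring and substitution, so both sides of a law can be reduced to
one iterated tensor product of the arrows involved without tracking associators or braidings;
`CohEquiv.eq` finally returns an equality. The domains of the two sides agree only by the laws of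
`P`. This is handled in `arr_eq_of_lab` by labelling positions with a fixed index type before
labelling them with objects. -/

namespace Word

open MonoidalCategory BraidedCategory

/-! ### Naturality of structure morphisms, and pointwise tensor products of families. -/

section Coherence

variable {L : Type w} {W : Type u} [Category.{v} W] [MonoidalCategory W]

/-- The tensor product, in the shape of a word, of a family of morphisms. -/
def hmap {f g : L → W} (φ : ∀ l, f l ⟶ g l) : (a : Word L) → (a.eval f ⟶ a.eval g)
  | of l => φ l
  | one => 𝟙 _
  | tensor a b => hmap φ a ⊗ₘ hmap φ b

instance isIso_hmap {f g : L → W} (φ : ∀ l, f l ⟶ g l) [∀ l, IsIso (φ l)] (a : Word L) :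
    IsIso (hmap φ a) := by
  induction a with
  | of l => exact inferInstanceAs (IsIso (φ l))
  | one => exact inferInstanceAs (IsIso (𝟙 _))
  | tensor a b iha ihb => exact inferInstanceAs (IsIso (hmap φ a ⊗ₘ hmap φ b))

/-- Every generating structure morphism is natural. For isomorphisms `φ` this transports coherence
from one family to an isomorphic one. -/
theorem Coh.eval_hmap [BraidedCategory W] {f g : L → W} (φ : ∀ l, f l ⟶ g l) {a b : Word L}
    (p : Coh a b) : p.eval f ≫ hmap φ b = hmap φ a ≫ p.eval g := by
  induction p with
  | id a => simp [Coh.eval]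
  | comp p q ihp ihq => simp [Coh.eval, ihq, reassoc_of% ihp]
  | tensor p q ihp ihq =>
    simp only [Coh.eval, hmap, Word.eval]
    rw [tensorHom_comp_tensorHom, ihp, ihq, ← tensorHom_comp_tensorHom]
  | assoc a b c => simp [Coh.eval, hmap, Word.eval]
  | assocInv a b c => exact (associator_inv_naturality _ _ _).symm
  | left a => simp [Coh.eval, hmap, Word.eval]
  | leftInv a => simp [Coh.eval, hmap, Word.eval]
  | right a => simp [Coh.eval, hmap, Word.eval]
  | rightInv a => simp [Coh.eval, hmap, Word.eval]
  | braid a b => exact (braiding_naturality _ _).symm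

/-- Tensoring two evaluations of a word letter by letter. -/
def tensorEval [BraidedCategory W] (f g : L → W) :
    (a : Word L) → (a.eval f ⊗ a.eval g ⟶ a.eval fun l => f l ⊗ g l)
  | of _ => 𝟙 _
  | one => (λ_ _).hom
  | tensor a b => tensorμ _ _ _ _ ≫ (tensorEval f g a ⊗ₘ tensorEval f g b)

instance isIso_tensorμ [BraidedCategory W] (X₁ X₂ Y₁ Y₂ : W) : IsIso (tensorμ X₁ X₂ Y₁ Y₂) :=
  ⟨tensorδ X₁ X₂ Y₁ Y₂, tensorμ_tensorδ _ _ _ _, tensorδ_tensorμ _ _ _ _⟩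

instance isIso_tensorEval [BraidedCategory W] (f g : L → W) (a : Word L) :
    IsIso (tensorEval f g a) := by
  induction a with
  | of l => exact inferInstanceAs (IsIso (𝟙 _))
  | one => exact inferInstanceAs (IsIso (λ_ _).hom)
  | tensor a b iha ihb =>
    exact inferInstanceAs (IsIso (tensorμ _ _ _ _ ≫ (tensorEval f g a ⊗ₘ tensorEval f g b)))

/-- The hexagons expand the braiding of the products into four braidings; the one of `A'` with `B`
undoes the middle exchange in `tensorμ`. This cancellation requires a symmetry rather than just a
braiding. -/
theorem tensorμ_comp_braiding [SymmetricCategory W] (A B A' B' : W) :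
    tensorμ A B A' B' ≫ (β_ (A ⊗ A') (B ⊗ B')).hom =
      ((β_ A B).hom ⊗ₘ (β_ A' B').hom) ≫ tensorμ B A B' A' := by
  simp [tensorμ, SymmetricCategory.braiding_swap_eq_inv_braiding A' B,
    MonoidalCategory.tensorHom_def]

theorem tensorEval_assoc [BraidedCategory W] (f g : L → W) (a b c : Word L) :
    tensorEval f g ((a.tensor b).tensor c) ≫ (Coh.assoc a b c).eval (fun l => f l ⊗ g l) =
      ((Coh.assoc a b c).eval f ⊗ₘ (Coh.assoc a b c).eval g) ≫
        tensorEval f g (a.tensor (b.tensor c)) := by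
  have h := associator_monoidal (a.eval f) (b.eval f) (c.eval f) (a.eval g) (b.eval g) (c.eval g)
  simp only [tensorEval, Coh.eval, Category.assoc, Word.eval]
  rw [← tensorHom_id, ← id_tensorHom] at h
  have h1 : (tensorμ (a.eval f) (b.eval f) (a.eval g) (b.eval g) ≫
        (tensorEval f g a ⊗ₘ tensorEval f g b)) ⊗ₘ tensorEval f g c =
      (tensorμ (a.eval f) (b.eval f) (a.eval g) (b.eval g) ⊗ₘ 𝟙 _) ≫
        ((tensorEval f g a ⊗ₘ tensorEval f g b) ⊗ₘ tensorEval f g c) := by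
    rw [tensorHom_comp_tensorHom, Category.id_comp]
  have h2 : tensorEval f g a ⊗ₘ (tensorμ (b.eval f) (c.eval f) (b.eval g) (c.eval g) ≫
        (tensorEval f g b ⊗ₘ tensorEval f g c)) =
      (𝟙 _ ⊗ₘ tensorμ (b.eval f) (c.eval f) (b.eval g) (c.eval g)) ≫
        (tensorEval f g a ⊗ₘ (tensorEval f g b ⊗ₘ tensorEval f g c)) := by
    rw [tensorHom_comp_tensorHom, Category.id_comp]
  rw [h1, h2, Category.assoc, associator_naturality, ← reassoc_of% h]

/-- This expresses that the tensor product functor, with `tensorμ` as its structure, is symmetric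
monoidal: it has to be checked on generators only. -/
theorem Coh.eval_tensorEval [SymmetricCategory W] (f g : L → W) {a b : Word L} (p : Coh a b) :
    tensorEval f g a ≫ p.eval (fun l => f l ⊗ g l) =
      (p.eval f ⊗ₘ p.eval g) ≫ tensorEval f g b := by
  -- The square for an inverse generator is obtained by inverting the square for the generator.
  have inv : ∀ {a b : Word L} (p : Coh a b) (q : Coh b a),
      (∀ h : L → W, p.eval h ≫ q.eval h = 𝟙 _) → (∀ h : L → W, q.eval h ≫ p.eval h = 𝟙 _) →
      tensorEval f g a ≫ p.eval (fun l => f l ⊗ g l) =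
        (p.eval f ⊗ₘ p.eval g) ≫ tensorEval f g b →
      tensorEval f g b ≫ q.eval (fun l => f l ⊗ g l) =
        (q.eval f ⊗ₘ q.eval g) ≫ tensorEval f g a := by
    intro a b p q h₁ h₂ e
    have h₃ : (q.eval f ⊗ₘ q.eval g) ≫ (p.eval f ⊗ₘ p.eval g) = 𝟙 _ := by
      rw [tensorHom_comp_tensorHom, h₂, h₂, id_tensorHom_id]
    rw [← Category.id_comp (tensorEval f g b), ← h₃, Category.assoc, Category.assoc, ← reassoc_of% e, h₁,
      Category.comp_id]
  have hleft : ∀ a : Word L, tensorEval f g (one.tensor a) ≫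
      (Coh.left a).eval (fun l => f l ⊗ g l) =
        ((Coh.left a).eval f ⊗ₘ (Coh.left a).eval g) ≫ tensorEval f g a := by
    intro a
    simp only [tensorEval, Coh.eval, leftUnitor_monoidal, Category.assoc, Word.eval]
    rw [MonoidalCategory.tensorHom_def]; simp
  have hright : ∀ a : Word L, tensorEval f g (a.tensor one) ≫
      (Coh.right a).eval (fun l => f l ⊗ g l) =
        ((Coh.right a).eval f ⊗ₘ (Coh.right a).eval g) ≫ tensorEval f g a := by
    intro a
    simp only [tensorEval, Coh.eval, rightUnitor_monoidal, Category.assoc, Word.eval]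
    rw [tensorHom_def']; simp
  induction p with
  | id a => simp [Coh.eval]
  | comp p q ihp ihq => simp [Coh.eval, reassoc_of% ihp, ihq]
  | tensor p q ihp ihq =>
    simp only [tensorEval, Coh.eval, Category.assoc, tensorHom_comp_tensorHom, ihp, ihq, Word.eval]
    rw [← tensorHom_comp_tensorHom, ← tensorμ_natural_assoc]
  | assoc a b c => exact tensorEval_assoc f g a b c
  | assocInv a b c =>
    exact inv (Coh.assoc a b c) _ (fun _ => Iso.hom_inv_id _) (fun _ => Iso.inv_hom_id _)
      (tensorEval_assoc f g a b c)
  | left a => exact hleft a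
  | leftInv a =>
    exact inv (Coh.left a) _ (fun _ => Iso.hom_inv_id _) (fun _ => Iso.inv_hom_id _) (hleft a)
  | right a => exact hright a
  | rightInv a =>
    exact inv (Coh.right a) _ (fun _ => Iso.hom_inv_id _) (fun _ => Iso.inv_hom_id _) (hright a)
  | braid a b =>
    simp only [tensorEval, Coh.eval, Category.assoc, Word.eval, braiding_naturality]
    rw [← Category.assoc, tensorμ_comp_braiding, Category.assoc]

/-! ### Contracting all letters, or all letters but one, to the unit object. -/

/-- `IsContr φ a m` says that all letters of `a` lie in the domain of `φ`, a partial family of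
morphisms to the unit object, and that `m` is the induced morphism to the unit object. -/
inductive IsContr {f : L → W} (U : L → Prop) (φ : ∀ l, U l → (f l ⟶ 𝟙_ W)) :
    (a : Word L) → (a.eval f ⟶ 𝟙_ W) → Prop
  | of (l : L) (h : U l) : IsContr U φ (of l) (φ l h)
  | one : IsContr U φ one (𝟙 _)
  | tensor {a b : Word L} {m n} : IsContr U φ a m → IsContr U φ b n →
      IsContr U φ (a.tensor b) ((m ⊗ₘ n) ≫ (λ_ _).hom)

/-- `IsProj φ l a m` says that `l` occurs exactly once in `a`, that all other letters of `a` lie in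
the domain of `φ`, and that `m` is the induced morphism to `f l`. -/
inductive IsProj {f : L → W} (U : L → Prop) (φ : ∀ l, U l → (f l ⟶ 𝟙_ W)) (l : L) :
    (a : Word L) → (a.eval f ⟶ f l) → Prop
  | of : IsProj U φ l (of l) (𝟙 _)
  | inl {a b : Word L} {m n} : IsProj U φ l a m → IsContr U φ b n →
      IsProj U φ l (a.tensor b) ((m ⊗ₘ n) ≫ (ρ_ _).hom)
  | inr {a b : Word L} {m n} : IsContr U φ a m → IsProj U φ l b n →
      IsProj U φ l (a.tensor b) ((m ⊗ₘ n) ≫ (λ_ _).hom)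

section Contr

variable {f : L → W} {U : L → Prop} {φ : ∀ l, U l → (f l ⟶ 𝟙_ W)} {l : L}

theorem IsContr.forall_mem {a : Word L} {m} (h : IsContr U φ a m) : ∀ x ∈ a.letters, U x := by
  induction h with
  | of l h => simpa [letters] using h
  | one => simp [letters]
  | tensor _ _ iha ihb =>
    intro x hx
    rcases Multiset.mem_add.1 hx with hx | hx
    exacts [iha x hx, ihb x hx]

theorem IsProj.mem {a : Word L} {m} (h : IsProj U φ l a m) : l ∈ a.letters := by
  induction h with
  | of => exact Multiset.mem_singleton_self _
  | inl _ _ ih => exact Multiset.mem_add.2 (.inl ih)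
  | inr _ _ ih => exact Multiset.mem_add.2 (.inr ih)

theorem IsContr.unique {a : Word L} {m m'} (h : IsContr U φ a m) (h' : IsContr U φ a m') :
    m = m' := by
  induction h with
  | of l h => cases h'; rfl
  | one => cases h'; rfl
  | tensor _ _ iha ihb => cases h' with | tensor ha hb => rw [iha ha, ihb hb]

/-- Since `l` is not contractible, the factor of a tensor containing `l` cannot be the contracted
one, so the word determines the whole derivation. -/
theorem IsProj.unique (hl : ¬ U l) {a : Word L} {m m'} (h : IsProj U φ l a m)
    (h' : IsProj U φ l a m') : m = m' := by
  induction h with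
  | of => cases h'; rfl
  | inl ha hb iha =>
    cases h' with
    | inl ha' hb' => rw [iha ha', hb.unique hb']
    | inr ha' hb' => exact (hl (ha'.forall_mem _ ha.mem)).elim
  | inr ha hb ihb =>
    cases h' with
    | inl ha' hb' => exact (hl (hb'.forall_mem _ hb.mem) ).elim
    | inr ha' hb' => rw [ihb hb', ha.unique ha']

theorem IsContr.isIso (hφ : ∀ l h, IsIso (φ l h)) {a : Word L} {m} (h : IsContr U φ a m) :
    IsIso m := by
  induction h with
  | of l h => exact hφ l h
  | one => exact inferInstanceAs (IsIso (𝟙 (𝟙_ W)))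
  | tensor _ _ iha ihb => exact IsIso.comp_isIso' (tensor_isIso _ _) inferInstance

theorem IsProj.isIso (hφ : ∀ l h, IsIso (φ l h)) {a : Word L} {m} (h : IsProj U φ l a m) :
    IsIso m := by
  induction h with
  | of => exact inferInstanceAs (IsIso (𝟙 (f l)))
  | inl _ hb ih =>
    have := hb.isIso hφ
    exact IsIso.comp_isIso' (tensor_isIso _ _) inferInstance
  | inr ha _ ih =>
    have := ha.isIso hφ
    exact IsIso.comp_isIso' (tensor_isIso _ _) inferInstance

theorem exists_isContr (φ : ∀ l, U l → (f l ⟶ 𝟙_ W)) (a : Word L) (h : ∀ x ∈ a.letters, U x) :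
    ∃ m, IsContr U φ a m := by
  induction a with
  | of l => exact ⟨_, .of l (h l (Multiset.mem_singleton_self _))⟩
  | one => exact ⟨_, .one⟩
  | tensor a b iha ihb =>
    obtain ⟨m, hm⟩ := iha fun x hx => h x (Multiset.mem_add.2 (.inl hx))
    obtain ⟨n, hn⟩ := ihb fun x hx => h x (Multiset.mem_add.2 (.inr hx))
    exact ⟨_, .tensor hm hn⟩

/-- Absence of repetitions is essential: it guarantees that in each tensor the factor not chosen to
contain `l` has contractible letters only. -/
theorem exists_isProj (φ : ∀ l, U l → (f l ⟶ 𝟙_ W)) (a : Word L) (hl : l ∈ a.letters)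
    (h : ∀ x, x ≠ l → U x) (ha : a.letters.Nodup) : ∃ m, IsProj U φ l a m := by
  induction a with
  | of x => obtain rfl := Multiset.mem_singleton.1 hl; exact ⟨_, .of⟩
  | one => simp [letters] at hl
  | tensor a b iha ihb =>
    obtain ⟨na, nb, d⟩ := Multiset.nodup_add.1 ha
    rcases Multiset.mem_add.1 hl with hl | hl
    · obtain ⟨m, hm⟩ := iha hl na
      obtain ⟨n, hn⟩ := exists_isContr φ b fun x hx => h x (by
        rintro rfl; exact Multiset.disjoint_left.1 d hl hx)
      exact ⟨_, .inl hm hn⟩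
    · obtain ⟨m, hm⟩ := ihb hl nb
      obtain ⟨n, hn⟩ := exists_isContr φ a fun x hx => h x (by
        rintro rfl; exact Multiset.disjoint_left.1 d hx hl)
      exact ⟨_, .inr hn hm⟩

theorem IsContr.congr {a : Word L} {m m'} (h : IsContr U φ a m) (e : m = m') :
    IsContr U φ a m' := e ▸ h

theorem IsProj.congr {a : Word L} {m m'} (h : IsProj U φ l a m) (e : m = m') :
    IsProj U φ l a m' := e ▸ h

end Contr

end Coherence

end Word

/-! ### The coherence theorem for symmetric monoidal categories. -/

namespace Word

open MonoidalCategory BraidedCategory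

section Coherence

variable {L : Type w} {W : Type u} [Category.{v} W] [MonoidalCategory W]

section UnitTensors

variable {A B C X : W}

/-- The three associativity lemmas differ in the factor which survives: the last here, the first in
`assoc_unit_right`, the middle one in `assoc_unit_outer`. -/
theorem assoc_unit_unit (m : A ⟶ 𝟙_ W) (n : B ⟶ 𝟙_ W) (p : C ⟶ X) :
    ((((m ⊗ₘ n) ≫ (λ_ _).hom) ⊗ₘ p) ≫ (λ_ _).hom) =
      (α_ A B C).hom ≫ (m ⊗ₘ ((n ⊗ₘ p) ≫ (λ_ _).hom)) ≫ (λ_ _).hom := by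
  simp [MonoidalCategory.tensorHom_def]

theorem assoc_unit_right (m : A ⟶ X) (n : B ⟶ 𝟙_ W) (p : C ⟶ 𝟙_ W) :
    ((((m ⊗ₘ n) ≫ (ρ_ _).hom) ⊗ₘ p) ≫ (ρ_ _).hom) =
      (α_ A B C).hom ≫ (m ⊗ₘ ((n ⊗ₘ p) ≫ (λ_ _).hom)) ≫ (ρ_ _).hom := by
  have h : (((m ⊗ₘ n) ≫ (ρ_ _).hom) ⊗ₘ p) = ((m ⊗ₘ n) ⊗ₘ p) ≫ ((ρ_ _).hom ⊗ₘ 𝟙 _) := by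
    rw [tensorHom_comp_tensorHom, Category.comp_id]
  have h' : (m ⊗ₘ ((n ⊗ₘ p) ≫ (λ_ _).hom)) = (m ⊗ₘ (n ⊗ₘ p)) ≫ (𝟙 _ ⊗ₘ (λ_ _).hom) := by
    rw [tensorHom_comp_tensorHom, Category.comp_id]
  rw [h, h', Category.assoc, Category.assoc, ← associator_naturality_assoc]
  congr 1
  monoidal

theorem assoc_unit_outer (m : A ⟶ 𝟙_ W) (n : B ⟶ X) (p : C ⟶ 𝟙_ W) :
    ((((m ⊗ₘ n) ≫ (λ_ _).hom) ⊗ₘ p) ≫ (ρ_ _).hom) =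
      (α_ A B C).hom ≫ (m ⊗ₘ ((n ⊗ₘ p) ≫ (ρ_ _).hom)) ≫ (λ_ _).hom := by
  have h : (((m ⊗ₘ n) ≫ (λ_ _).hom) ⊗ₘ p) = ((m ⊗ₘ n) ⊗ₘ p) ≫ ((λ_ _).hom ⊗ₘ 𝟙 _) := by
    rw [tensorHom_comp_tensorHom, Category.comp_id]
  have h' : (m ⊗ₘ ((n ⊗ₘ p) ≫ (ρ_ _).hom)) = (m ⊗ₘ (n ⊗ₘ p)) ≫ (𝟙 _ ⊗ₘ (ρ_ _).hom) := by
    rw [tensorHom_comp_tensorHom, Category.comp_id]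
  rw [h, h', Category.assoc, Category.assoc, ← associator_naturality_assoc]
  congr 1
  monoidal

theorem id_tensor_unit (m : A ⟶ X) : (𝟙 _ ⊗ₘ m) ≫ (λ_ X).hom = (λ_ A).hom ≫ m := by simp

theorem tensor_id_unit (m : A ⟶ X) : (m ⊗ₘ 𝟙 _) ≫ (ρ_ X).hom = (ρ_ A).hom ≫ m := by simp

theorem braid_unit_left [BraidedCategory W] (m : A ⟶ X) (n : B ⟶ 𝟙_ W) :
    (n ⊗ₘ m) ≫ (λ_ X).hom = (β_ B A).hom ≫ (m ⊗ₘ n) ≫ (ρ_ X).hom := by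
  rw [← braiding_naturality_assoc, braiding_rightUnitor]

theorem braid_unit_right [BraidedCategory W] (m : A ⟶ X) (n : B ⟶ 𝟙_ W) :
    (m ⊗ₘ n) ≫ (ρ_ X).hom = (β_ A B).hom ≫ (n ⊗ₘ m) ≫ (λ_ X).hom := by
  rw [← braiding_naturality_assoc, braiding_leftUnitor]

theorem comp_tensor_unit {A' B' Y Z V : W} (p : A ⟶ A') (q : B ⟶ B') (m : A' ⟶ Y) (n : B' ⟶ Z)
    (e : Y ⊗ Z ⟶ V) : ((p ≫ m) ⊗ₘ (q ≫ n)) ≫ e = (p ⊗ₘ q) ≫ (m ⊗ₘ n) ≫ e := by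
  rw [tensorHom_comp_tensorHom_assoc]

end UnitTensors

variable {f : L → W} {U : L → Prop} {φ : ∀ l, U l → (f l ⟶ 𝟙_ W)} {l : L}

/-- Naturality of the generators combined with coherence of the unit object. Together with
`IsContr.unique` it shows that all structure morphisms from `a` to `b` have the same composite with
`m`. -/
theorem IsContr.coh [SymmetricCategory W] {a b : Word L} (p : Coh a b) {m}
    (h : IsContr U φ b m) : IsContr U φ a (p.eval f ≫ m) := by
  induction p with
  | id a => exact h.congr (Category.id_comp _).symm
  | comp p q ihp ihq => exact (ihp (ihq h)).congr (Category.assoc _ _ _).symm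
  | tensor p q ihp ihq =>
    cases h with | tensor h₁ h₂ =>
    exact (IsContr.tensor (ihp h₁) (ihq h₂)).congr (comp_tensor_unit _ _ _ _ _)
  | assoc a b c =>
    rcases h with _ | _ | ⟨h₁, _ | _ | ⟨h₂, h₃⟩⟩
    exact (IsContr.tensor (IsContr.tensor h₁ h₂) h₃).congr (assoc_unit_unit _ _ _)
  | assocInv a b c =>
    rcases h with _ | _ | ⟨_ | _ | ⟨h₁, h₂⟩, h₃⟩
    exact (IsContr.tensor h₁ (IsContr.tensor h₂ h₃)).congr
      ((Iso.eq_inv_comp _).2 (assoc_unit_unit _ _ _).symm)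
  | left a => exact (IsContr.tensor IsContr.one h).congr (id_tensor_unit _)
  | leftInv a =>
    rcases h with _ | _ | ⟨_ | _ | _, h⟩
    exact h.congr ((Iso.eq_inv_comp _).2 (id_tensor_unit _).symm)
  | right a =>
    refine (IsContr.tensor h IsContr.one).congr ?_
    -- `IsContr.tensor` is defined with the left unitor, whereas a right unitor occurs here; the two
    -- coincide on the unit object.
    rw [unitors_equal]
    exact tensor_id_unit _
  | rightInv a =>
    rcases h with _ | _ | ⟨h, _ | _ | _⟩
    refine h.congr ((Iso.eq_inv_comp _).2 ?_)
    rw [unitors_equal]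
    exact (tensor_id_unit _).symm
  | braid a b =>
    rcases h with _ | _ | ⟨h₁, h₂⟩
    refine (IsContr.tensor h₂ h₁).congr ((braid_unit_left _ _).trans ?_)
    rw [unitors_equal]; rfl

theorem IsProj.coh [SymmetricCategory W] {a b : Word L} (p : Coh a b) {m}
    (h : IsProj U φ l b m) : IsProj U φ l a (p.eval f ≫ m) := by
  induction p with
  | id a => exact h.congr (Category.id_comp _).symm
  | comp p q ihp ihq => exact (ihp (ihq h)).congr (Category.assoc _ _ _).symm
  | tensor p q ihp ihq =>
    rcases h with _ | ⟨h₁, h₂⟩ | ⟨h₁, h₂⟩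
    · exact (IsProj.inl (ihp h₁) (h₂.coh q)).congr (comp_tensor_unit _ _ _ _ _)
    · exact (IsProj.inr (h₁.coh p) (ihq h₂)).congr (comp_tensor_unit _ _ _ _ _)
  | assoc a b c =>
    -- The surviving letter lies in the first, the second or the third factor.
    rcases h with _ | ⟨h₁, _ | _ | ⟨h₂, h₃⟩⟩ | ⟨h₁, _ | ⟨h₂, h₃⟩ | ⟨h₂, h₃⟩⟩
    · exact (IsProj.inl (IsProj.inl h₁ h₂) h₃).congr (assoc_unit_right _ _ _)
    · exact (IsProj.inl (IsProj.inr h₁ h₂) h₃).congr (assoc_unit_outer _ _ _)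
    · exact (IsProj.inr (IsContr.tensor h₁ h₂) h₃).congr (assoc_unit_unit _ _ _)
  | assocInv a b c =>
    rcases h with _ | ⟨_ | ⟨h₁, h₂⟩ | ⟨h₁, h₂⟩, h₃⟩ | ⟨_ | _ | ⟨h₁, h₂⟩, h₃⟩
    · exact (IsProj.inl h₁ (IsContr.tensor h₂ h₃)).congr
        ((Iso.eq_inv_comp _).2 (assoc_unit_right _ _ _).symm)
    · exact (IsProj.inr h₁ (IsProj.inl h₂ h₃)).congr
        ((Iso.eq_inv_comp _).2 (assoc_unit_outer _ _ _).symm)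
    · exact (IsProj.inr h₁ (IsProj.inr h₂ h₃)).congr
        ((Iso.eq_inv_comp _).2 (assoc_unit_unit _ _ _).symm)
  | left a => exact (IsProj.inr IsContr.one h).congr (id_tensor_unit _)
  | leftInv a =>
    rcases h with _ | ⟨_ | _ | _, h⟩ | ⟨_ | _ | _, h⟩
    exact h.congr ((Iso.eq_inv_comp _).2 (id_tensor_unit _).symm)
  | right a => exact (IsProj.inl h IsContr.one).congr (tensor_id_unit _)
  | rightInv a =>
    rcases h with _ | ⟨h, _ | _ | _⟩ | ⟨_, _ | _ | _⟩
    exact h.congr ((Iso.eq_inv_comp _).2 (tensor_id_unit _).symm)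
  | braid a b =>
    rcases h with _ | ⟨h₁, h₂⟩ | ⟨h₁, h₂⟩
    · exact (IsProj.inr h₂ h₁).congr (braid_unit_left _ _)
    · exact (IsProj.inl h₂ h₁).congr (braid_unit_right _ _)

theorem Coh.letters_eq {a b : Word L} (p : Coh a b) : a.letters = b.letters := by
  induction p with
  | id a => rfl
  | comp p q ihp ihq => exact ihp.trans ihq
  | tensor p q ihp ihq => simp only [letters, ihp, ihq]
  | assoc a b c => exact add_assoc _ _ _
  | assocInv a b c => exact (add_assoc _ _ _).symm
  | left a => exact zero_add _
  | leftInv a => exact (zero_add _).symm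
  | right a => exact add_zero _
  | rightInv a => exact (add_zero _).symm
  | braid a b => exact add_comm _ _

theorem Coh.eval_eq_of_contr [SymmetricCategory W] (i : ∀ l, f l ≅ 𝟙_ W)
    {a b : Word L} (p q : Coh a b) : p.eval f = q.eval f := by
  obtain ⟨m, hm⟩ := exists_isContr (U := fun _ => True) (fun l _ => (i l).hom) b fun _ _ => trivial
  have := hm.isIso fun l _ => inferInstance
  exact (cancel_mono m).1 ((hm.coh p).unique (hm.coh q))

/-- Both interpretations followed by the projection of `b` are the projection of `a`, and the
projection of `b` is an isomorphism. If `l` does not occur, contraction to the unit is used in the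
same way. -/
theorem Coh.eval_eq_of_proj [SymmetricCategory W] (l : L) (i : ∀ x, x ≠ l → (f x ≅ 𝟙_ W))
    {a b : Word L} (p q : Coh a b) (h : a.letters.Nodup) : p.eval f = q.eval f := by
  have hb : b.letters.Nodup := p.letters_eq ▸ h
  by_cases hl : l ∈ b.letters
  · obtain ⟨m, hm⟩ := exists_isProj (U := (· ≠ l)) (fun x hx => (i x hx).hom) b hl
      (fun _ hx => hx) hb
    have := hm.isIso fun l _ => inferInstance
    exact (cancel_mono m).1 ((hm.coh p).unique (fun h => h rfl) (hm.coh q))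
  · obtain ⟨m, hm⟩ := exists_isContr (U := (· ≠ l)) (fun x hx => (i x hx).hom) b
      fun x hx => by rintro rfl; exact hl hx
    have := hm.isIso fun l _ => inferInstance
    exact (cancel_mono m).1 ((hm.coh p).unique (hm.coh q))

theorem Coh.eval_eq_of_iso [SymmetricCategory W] {f g : L → W} (i : ∀ l, f l ≅ g l)
    {a b : Word L} (p q : Coh a b) (h : p.eval f = q.eval f) : p.eval g = q.eval g := by
  have hp := p.eval_hmap fun l => (i l).hom
  have hq := q.eval_hmap fun l => (i l).hom
  exact (cancel_epi (hmap (fun l => (i l).hom) a)).1 (hp.symm.trans (h ▸ hq))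

theorem Coh.eval_eq_of_tensor [SymmetricCategory W] {f g : L → W}
    {a b : Word L} (p q : Coh a b) (hf : p.eval f = q.eval f) (hg : p.eval g = q.eval g) :
    p.eval (fun l => f l ⊗ g l) = q.eval (fun l => f l ⊗ g l) := by
  refine (cancel_epi (tensorEval f g a)).1 ?_
  rw [Coh.eval_tensorEval, Coh.eval_tensorEval, hf, hg]

/-- Induction on a finite set outside of which the family is trivial; one letter is split off as a
tensor factor at each step. -/
theorem Coh.eval_eq_of_finset [SymmetricCategory W] {a b : Word L} (p q : Coh a b)
    (h : a.letters.Nodup) (s : Finset L) (f : L → W) (i : ∀ l, l ∉ s → (f l ≅ 𝟙_ W)) :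
    p.eval f = q.eval f := by
  classical
  induction s using Finset.induction_on generalizing f with
  | empty => exact eval_eq_of_contr (fun l => i l (Finset.notMem_empty l)) p q
  | insert l s _ ih =>
    -- Here `f₁` is concentrated at `l`, while `f₂` is trivial at `l` and falls under the induction
    -- hypothesis. Pointwise, `f` is their tensor product up to a unitor.
    let f₁ : L → W := fun x => if x = l then f x else 𝟙_ W
    let f₂ : L → W := fun x => if x = l then 𝟙_ W else f x
    have e : ∀ x, f₁ x ⊗ f₂ x ≅ f x := fun x => by
      by_cases hx : x = l
      · exact ((eqToIso (if_pos hx)) ⊗ᵢ (eqToIso (if_pos hx))) ≪≫ ρ_ _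
      · exact ((eqToIso (if_neg hx)) ⊗ᵢ (eqToIso (if_neg hx))) ≪≫ λ_ _
    refine eval_eq_of_iso e p q (eval_eq_of_tensor p q ?_ ?_)
    · exact eval_eq_of_proj l (fun x hx => eqToIso (if_neg hx)) p q h
    · refine ih f₂ fun x hx => ?_
      by_cases hx' : x = l
      · exact eqToIso (if_pos hx')
      · exact eqToIso (if_neg hx') ≪≫ i x (by simp [hx, hx'])

/-- Coherence for symmetric monoidal categories. -/
theorem Coh.eval_unique [SymmetricCategory W] [Finite L] (f : L → W) {a b : Word L} (p q : Coh a b)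
    (h : a.letters.Nodup) : p.eval f = q.eval f := by
  have := Fintype.ofFinite L
  exact p.eval_eq_of_finset q h Finset.univ f fun l hl => (hl (Finset.mem_univ l)).elim

end Coherence

end Word

/-! ### Substitution of words, and equality up to structural isomorphism. -/

namespace Word

open MonoidalCategory BraidedCategory

section Substitution

variable {L L' L'' : Type w} {W : Type u} [Category.{v} W] [MonoidalCategory W]

theorem comp_unit_inv {A X : W} (m : A ⟶ X) : m ≫ (λ_ X).inv = (λ_ A).inv ≫ (𝟙 _ ⊗ₘ m) := by
  simp

theorem comp_inv_unit {A X : W} (m : A ⟶ X) : m ≫ (ρ_ X).inv = (ρ_ A).inv ≫ (m ⊗ₘ 𝟙 _) := by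
  simp

variable [SymmetricCategory W]


/-- Substitution of words for letters in a formal composite of structure morphisms. -/
def Coh.bind (ρ : L → Word L') : {a b : Word L} → Coh a b → Coh (a.bind ρ) (b.bind ρ)
  | _, _, .id _ => .id _
  | _, _, .comp p q => .comp (p.bind ρ) (q.bind ρ)
  | _, _, .tensor p q => .tensor (p.bind ρ) (q.bind ρ)
  | _, _, .assoc _ _ _ => .assoc _ _ _
  | _, _, .assocInv _ _ _ => .assocInv _ _ _
  | _, _, .left _ => .left _
  | _, _, .leftInv _ => .leftInv _
  | _, _, .right _ => .right _
  | _, _, .rightInv _ => .rightInv _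
  | _, _, .braid _ _ => .braid _ _

/-- Naturality again, now for families of morphisms whose sources are themselves tensor products; it
makes `CohEquiv` stable under substitution. -/
theorem Coh.evalBind_eval {f : L' → W} {g : L → W} (ρ : L → Word L')
    (κ : ∀ l, (ρ l).eval f ⟶ g l) {a b : Word L} (p : Coh a b) :
    a.evalBind ρ κ ≫ p.eval g = (p.bind ρ).eval f ≫ b.evalBind ρ κ := by
  induction p with
  | id a => exact (Category.comp_id _).trans (Category.id_comp _).symm
  | comp p q ihp ihq =>
    simp only [Coh.eval, Coh.bind, Category.assoc]
    rw [reassoc_of% ihp, ihq]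
  | tensor p q ihp ihq =>
    refine (tensorHom_comp_tensorHom _ _ _ _).trans ?_
    rw [ihp, ihq]
    exact (tensorHom_comp_tensorHom _ _ _ _).symm
  | assoc a b c => exact associator_naturality _ _ _
  | assocInv a b c => exact associator_inv_naturality _ _ _
  | left a => exact id_tensor_unit _
  | leftInv a => exact comp_unit_inv _
  | right a => exact tensor_id_unit _
  | rightInv a => exact comp_inv_unit _
  | braid a b => exact braiding_naturality _ _

/-- The inverse of a formal composite of structure morphisms. -/
def Coh.symm : {a b : Word L} → Coh a b → Coh b a
  | _, _, .id _ => .id _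
  | _, _, .comp p q => .comp q.symm p.symm
  | _, _, .tensor p q => .tensor p.symm q.symm
  | _, _, .assoc _ _ _ => .assocInv _ _ _
  | _, _, .assocInv _ _ _ => .assoc _ _ _
  | _, _, .left _ => .leftInv _
  | _, _, .leftInv _ => .left _
  | _, _, .right _ => .rightInv _
  | _, _, .rightInv _ => .right _
  | _, _, .braid _ _ => .braid _ _

theorem Coh.eval_symm_comp (f : L → W) {a b : Word L} (p : Coh a b) :
    p.symm.eval f ≫ p.eval f = 𝟙 _ := by
  induction p with
  | id a => exact Category.comp_id _
  | comp p q ihp ihq =>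
    simp only [Coh.eval, Coh.symm, Category.assoc]
    rw [reassoc_of% ihp, ihq]
  | tensor p q ihp ihq =>
    refine (tensorHom_comp_tensorHom _ _ _ _).trans ?_
    rw [ihp, ihq]
    exact id_tensorHom_id _ _
  | assoc a b c => exact Iso.inv_hom_id _
  | assocInv a b c => exact Iso.hom_inv_id _
  | left a => exact Iso.inv_hom_id _
  | leftInv a => exact Iso.hom_inv_id _
  | right a => exact Iso.inv_hom_id _
  | rightInv a => exact Iso.hom_inv_id _
  | braid a b => exact SymmetricCategory.symmetry _ _

/-- Two morphisms from tensor products of the same family agree up to a structural isomorphism. -/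
def CohEquiv {f : L → W} {x y : Word L} {Z : W} (m : x.eval f ⟶ Z) (m' : y.eval f ⟶ Z) : Prop :=
  ∃ p : Coh x y, m = p.eval f ≫ m'

namespace CohEquiv

theorem of_eq {f : L → W} {x : Word L} {Z : W} {m m' : x.eval f ⟶ Z} (h : m = m') :
    CohEquiv m m' := ⟨.id x, h.trans (Category.id_comp _).symm⟩

theorem symm {f : L → W} {x y : Word L} {Z : W} {m : x.eval f ⟶ Z} {m' : y.eval f ⟶ Z}
    (h : CohEquiv m m') : CohEquiv m' m := by
  obtain ⟨p, rfl⟩ := h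
  exact ⟨p.symm, by rw [← Category.assoc, p.eval_symm_comp, Category.id_comp]⟩

theorem trans {f : L → W} {x y z : Word L} {Z : W} {m : x.eval f ⟶ Z} {m' : y.eval f ⟶ Z}
    {m'' : z.eval f ⟶ Z} (h : CohEquiv m m') (h' : CohEquiv m' m'') : CohEquiv m m'' := by
  obtain ⟨p, rfl⟩ := h
  obtain ⟨q, rfl⟩ := h'
  exact ⟨p.comp q, (Category.assoc _ _ _).symm⟩

theorem comp_right {f : L → W} {x y : Word L} {Z Z' : W} {m : x.eval f ⟶ Z} {m' : y.eval f ⟶ Z}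
    (h : CohEquiv m m') (n : Z ⟶ Z') : CohEquiv (m ≫ n) (m' ≫ n) := by
  obtain ⟨p, rfl⟩ := h
  exact ⟨p, Category.assoc _ _ _⟩

/-- The passage from the calculus of `CohEquiv` back to equations: by coherence a structural
endomorphism of a word without repetitions is the identity. -/
theorem eq [Finite L] {f : L → W} {x : Word L} {Z : W} {m m' : x.eval f ⟶ Z}
    (h : CohEquiv m m') (hx : x.letters.Nodup) : m = m' := by
  obtain ⟨p, rfl⟩ := h
  rw [p.eval_unique f (.id x) hx]
  exact Category.id_comp _

theorem evalBind_comp {f : L' → W} {g : L → W} (ρ : L → Word L')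
    (κ : ∀ l, (ρ l).eval f ⟶ g l) {x y : Word L} {Z : W} {m : x.eval g ⟶ Z} {m' : y.eval g ⟶ Z}
    (h : CohEquiv m m') : CohEquiv (x.evalBind ρ κ ≫ m) (y.evalBind ρ κ ≫ m') := by
  obtain ⟨p, rfl⟩ := h
  exact ⟨p.bind ρ, by rw [← Category.assoc, p.evalBind_eval, Category.assoc]⟩

theorem tensor {f : L → W} {x y x' y' : Word L} {Z Z' : W} {m : x.eval f ⟶ Z} {m' : y.eval f ⟶ Z}
    {n : x'.eval f ⟶ Z'} {n' : y'.eval f ⟶ Z'} (h : CohEquiv m m') (h' : CohEquiv n n') :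
    CohEquiv (x := x.tensor x') (y := y.tensor y') (m ⊗ₘ n) (m' ⊗ₘ n') := by
  obtain ⟨p, rfl⟩ := h
  obtain ⟨q, rfl⟩ := h'
  exact ⟨.tensor p q, (tensorHom_comp_tensorHom _ _ _ _).symm⟩

theorem evalBind {f : L' → W} {g : L → W} (a : Word L)
    {ρ ρ' : L → Word L'} {κ : ∀ l, (ρ l).eval f ⟶ g l} {κ' : ∀ l, (ρ' l).eval f ⟶ g l}
    (h : ∀ l, CohEquiv (κ l) (κ' l)) : CohEquiv (a.evalBind ρ κ) (a.evalBind ρ' κ') := by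
  induction a with
  | of l => exact h l
  | one => exact of_eq rfl
  | tensor a b iha ihb => exact iha.tensor ihb

/-- The two iterated substitutions are not definitionally the same word, so the sources differ as
types. `CohEquiv` absorbs this difference, and no transport along an equality of words is needed. -/
theorem evalBind_evalBind {f : L'' → W} {g : L' → W} {h : L → W} (a : Word L)
    (ρ : L → Word L') (κ : ∀ l, (ρ l).eval g ⟶ h l) (ρ' : L' → Word L'')
    (κ' : ∀ l, (ρ' l).eval f ⟶ g l) :
    CohEquiv ((a.bind ρ).evalBind ρ' κ' ≫ a.evalBind ρ κ)
      (a.evalBind (fun l => (ρ l).bind ρ') fun l => (ρ l).evalBind ρ' κ' ≫ κ l) := by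
  induction a with
  | of l => exact of_eq rfl
  | one => exact of_eq (Category.comp_id _)
  | tensor a b iha ihb => exact (of_eq (tensorHom_comp_tensorHom _ _ _ _)).trans (iha.tensor ihb)

theorem evalBind_of (f : L → W) (a : Word L) :
    CohEquiv (a.evalBind of fun l => 𝟙 (f l)) (𝟙 (a.eval f)) := by
  induction a with
  | of l => exact of_eq rfl
  | one => exact of_eq rfl
  | tensor a b iha ihb => exact (iha.tensor ihb).trans (of_eq (id_tensorHom_id _ _))

/-- Modulo `CohEquiv` the chosen isomorphism `canon` may be dropped, whichever formal composite was
chosen. -/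
theorem canon_comp {f : L → W} {x y : Word L} (h : x.letters = y.letters) {Z : W}
    (m : y.eval f ⟶ Z) : CohEquiv (canon f x y h ≫ m) m :=
  ⟨(nonempty_coh x y h).some, rfl⟩

end CohEquiv

end Substitution

end Word

/-! ### Lifting words along labellings. -/

theorem Multiset.exists_add_of_map_eq_add {α β : Type*} (f : α → β) (m : Multiset α)
    (s t : Multiset β) (h : m.map f = s + t) :
    ∃ m₁ m₂, m = m₁ + m₂ ∧ m₁.map f = s ∧ m₂.map f = t := by
  induction s using Multiset.induction_on generalizing m with
  | empty => exact ⟨0, m, (zero_add _).symm, rfl, by simpa using h⟩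
  | cons b s ih =>
    obtain ⟨x, hx, rfl⟩ := Multiset.mem_map.1
      (show b ∈ m.map f from h ▸ Multiset.mem_add.2 (.inl (Multiset.mem_cons_self b s)))
    obtain ⟨m', rfl⟩ := Multiset.exists_cons_of_mem hx
    rw [Multiset.map_cons, Multiset.cons_add, Multiset.cons_inj_right] at h
    obtain ⟨m₁, m₂, rfl, rfl, rfl⟩ := ih m' h
    exact ⟨x ::ₘ m₁, m₂, (Multiset.cons_add _ _ _).symm, Multiset.map_cons _ _ _, rfl⟩

namespace Word

/-- A decomposition of the multiset of labels at a tensor lifts to a decomposition of the multiset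
of positions. The lift is not unique when labels repeat, which is why a tensor choice records words
in positions. -/
theorem exists_eval_eq {L : Type w} {W : Type u} [Category.{v} W] [MonoidalCategory W]
    (f : L → W) (m : Multiset L) (a : Word W) (h : a.letters = m.map f) :
    ∃ b : Word L, b.letters = m ∧ b.eval f = a.eval fun x => x := by
  induction a generalizing m with
  | of x =>
    obtain ⟨l, rfl, rfl⟩ := Multiset.map_eq_singleton.1 h.symm
    exact ⟨.of l, rfl, rfl⟩
  | one => exact ⟨.one, (Multiset.map_eq_zero.1 h.symm).symm, rfl⟩
  | tensor a b iha ihb =>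
    obtain ⟨m₁, m₂, rfl, h₁, h₂⟩ := Multiset.exists_add_of_map_eq_add f m _ _ h.symm
    obtain ⟨c, hc, ec⟩ := iha m₁ h₁.symm
    obtain ⟨d, hd, ed⟩ := ihb m₂ h₂.symm
    exact ⟨c.tensor d, by simp only [letters, hc, hd], by simp only [eval, ec, ed]⟩

theorem exists_letters_eq {L : Type w} (m : Multiset L) : ∃ a : Word L, a.letters = m := by
  induction m using Multiset.induction_on with
  | empty => exact ⟨.one, rfl⟩
  | cons l m ih =>
    obtain ⟨a, rfl⟩ := ih
    exact ⟨(Word.of l).tensor a, rfl⟩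

end Word

/-! ### The monad opfunctor, and existence of tensor choices. -/

namespace PolyMonad

theorem map_positions_bind (P : PolyMonad.{w}) {X : Type w} (o : P.Op) (ρ : P.Ar o → P.Lab X)
    (h : ∀ i, P.tgt (ρ i).1 = P.src o i) :
    (P.positions (P.bind o ρ h).1).map (P.bind o ρ h).2 =
      (P.positions o).bind fun i => (P.positions (ρ i).1).map (ρ i).2 := by
  -- Only the values of the labelling at the inputs given by `pos` matter; replacing it by an
  -- arbitrary `g` with these values avoids the inverse of `pos` in the definition of `bind`.
  have key : ∀ g : P.Ar (P.sub o (fun i => (ρ i).1) h) → X,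
      (∀ i q, g (P.pos o (fun i => (ρ i).1) h ⟨i, q⟩) = (ρ i).2 q) →
      (P.positions (P.sub o (fun i => (ρ i).1) h)).map g =
        (P.positions o).bind fun i => (P.positions (ρ i).1).map (ρ i).2 := by
    intro g hg
    rw [positions_sub, Multiset.map_bind]
    refine congrArg Multiset.join (Multiset.map_congr rfl fun i _ => ?_)
    rw [Multiset.map_map]
    exact Multiset.map_congr rfl fun q _ => hg i q
  exact key _ (P.bind_snd_pos o ρ h)

theorem isMonadOpfunctor_theta (P : PolyMonad.{w}) :
    IsMonadOpfunctor P.monad (ofTypeMonad.{w} Multiset) (Over.forget P.S) P.theta where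
  unit X := by
    ext x
    change (P.positions (P.unit (X.hom x))).map (fun _ => x) = {x}
    rw [positions_unit, Multiset.map_singleton]
  mul X := by
    ext z
    let z : P.Diag (P.extObj X) := z
    let ρ : P.Ar z.lab.1 → P.Diag X := z.lab.2
    refine (P.map_positions_bind z.lab.1 (fun i => (ρ i).lab) z.typed).trans ?_
    change _ = Multiset.bind (((P.positions z.lab.1).map ρ).map
      fun t => (P.positions t.lab.1).map t.lab.2) id
    rw [Multiset.map_map, Multiset.bind_map]
    rfl

theorem nodup_positions (P : PolyMonad.{w}) (o : P.Op) : (P.positions o).Nodup :=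
  (@Finset.univ _ (@Fintype.ofFinite _ (P.finite_ar o))).nodup

section TensorChoice

variable (P : PolyMonad.{max u v}) {W : Type u} [Category.{v} W] [MonoidalCategory W]

theorem exists_tensorChoice (τ : Multiset W → W)
    (hτ : ∀ m, ∃ a : Word W, a.letters = m ∧ a.eval (fun x => x) = τ m) :
    ∃ c : P.TensorChoice W, c.tensor = τ := by
  have h : ∀ (o : P.Op) (f : P.Ar o → W), ∃ b : Word (P.Ar o), b.letters = P.positions o ∧
      b.eval f = τ ((P.positions o).map f) := by
    intro o f
    obtain ⟨a, ha, e⟩ := hτ ((P.positions o).map f)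
    obtain ⟨b, hb, e'⟩ := Word.exists_eval_eq f _ a ha
    exact ⟨b, hb, e'.trans e⟩
  choose word letters eval using h
  exact ⟨⟨τ, hτ, word, letters, eval⟩, rfl⟩

theorem nonempty_tensorChoice : Nonempty (P.TensorChoice W) := by
  choose a ha using fun m : Multiset W => Word.exists_letters_eq m
  obtain ⟨c, -⟩ := P.exists_tensorChoice (fun m => (a m).eval fun x => x)
    fun m => ⟨a m, ha m, rfl⟩
  exact ⟨c⟩

end TensorChoice

end PolyMonad

/-! ### Arrows and their composites modulo structural isomorphisms. -/

namespace PolyMonad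

namespace TensorChoice

variable {P : PolyMonad.{max u v}} {W : Type u} [Category.{v} W] [MonoidalCategory W]
  (c c' : P.TensorChoice W)

/-- The objects of `W` which label the inputs of a diagram. -/
def labels (t : P.Diag (P.smcOb W)) : P.Ar t.lab.1 → W := fun i => (t.lab.2 i).1

/-- The morphism underlying an arrow, defined on the tensor product of the labels of its domain. -/
noncomputable def srcHom (k : c.Arr) : (c.srcWord k.dom).eval (labels k.dom) ⟶ k.cod :=
  eqToHom (c.eval_srcWord k.dom) ≫ k.hom

theorem nodup_srcWord (t : P.Diag (P.smcOb W)) : (c.srcWord t).letters.Nodup :=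
  (c.word_letters _ _).symm ▸ P.nodup_positions _

theorem Arr.ext_srcHom {k k' : c.Arr} (hd : k.dom = k'.dom) (hc : k.cod = k'.cod)
    (h : ∀ (e : (c.srcWord k.dom).eval (labels k.dom) = (c.srcWord k'.dom).eval (labels k'.dom)),
      c.srcHom k ≫ eqToHom hc = eqToHom e ≫ c.srcHom k') : k = k' := by
  obtain ⟨d, x, f⟩ := k
  obtain ⟨d', x', f'⟩ := k'
  obtain rfl : d = d' := hd
  obtain rfl : x = x' := hc
  have := h rfl
  simp only [srcHom, eqToHom_refl, Category.comp_id, Category.id_comp] at this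
  obtain rfl : f = f' := (cancel_epi (eqToHom (c.eval_srcWord d))).1 this
  rfl

/-- Relabelling the inputs of the domain of an arrow. -/
noncomputable def arrMap (k : c.Arr) {L : Type (max u v)} (ε : P.Ar k.dom.lab.1 → L) (f : L → W)
    (hε : ∀ q, f (ε q) = labels k.dom q) : ((c.srcWord k.dom).map ε).eval f ⟶ k.cod :=
  (c.srcWord k.dom).evalBind (fun q => .of (ε q)) (fun q => eqToHom (hε q)) ≫ c.srcHom k

/-- The composite of all the domains of a diagram of arrows. -/
abbrev domDiag (z : P.Diag c.arr) : P.Diag (P.smcOb W) :=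
  (P.monad.map c.arrDom ≫ P.monad.μ.app (P.smcOb W)).left z

/-- The diagram of the codomains of a diagram of arrows. -/
abbrev codDiag (z : P.Diag c.arr) : P.Diag (P.smcOb W) := (P.monad.map c.arrCod).left z

/-- The arrows in a diagram of arrows. -/
def arrows (z : P.Diag c.arr) : P.Ar z.lab.1 → c.Arr := z.lab.2

/-- The inclusion of the inputs of the domain of an arrow in a diagram `z` of arrows into the inputs
of the composite of all the domains. -/
def incl (z : P.Diag c.arr) (i : P.Ar z.lab.1) (q : P.Ar (c.arrows z i).dom.lab.1) :
    P.Ar (Diag.lab (X := P.smcOb W) (c.domDiag z)).1 :=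
  P.pos z.lab.1 (fun i => (c.arrows z i).dom.lab.1) z.typed ⟨i, q⟩

theorem labels_incl (z : P.Diag c.arr) (i : P.Ar z.lab.1) (q : P.Ar (c.arrows z i).dom.lab.1) :
    labels (c.domDiag z) (c.incl z i q) =
      labels (c.arrows z i).dom q :=
  congrArg Prod.fst (P.bind_snd_pos z.lab.1 (fun i => (c.arrows z i).dom.lab) z.typed i q)

/-- Naturality of the multiplication at the codomain map, followed by the pullback condition inside
each position of `y`. It makes the outer composite on the right of associativity well formed. -/
theorem codDiag_map_fst (y : P.Diag (pullback (P.monad.map c.arrCod) c.arrDom)) :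
    c.codDiag ((P.monad.μ.app c.arr).left ((P.monad.map
        (pullback.fst (P.monad.map c.arrCod) c.arrDom)).left y)) =
      c.domDiag ((P.monad.map (pullback.snd (P.monad.map c.arrCod) c.arrDom)).left y) :=
  (congrArg (fun f : P.monad.obj (P.monad.obj c.arr) ⟶ P.monad.obj (P.smcOb W) =>
    f.left ((P.monad.map (pullback.fst (P.monad.map c.arrCod) c.arrDom)).left y))
    (P.monad.μ.naturality c.arrCod)).symm.trans
    (congrArg (fun f : pullback (P.monad.map c.arrCod) c.arrDom ⟶ P.monad.obj (P.smcOb W) =>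
      (P.monad.μ.app (P.smcOb W)).left ((P.monad.map f).left y)) pullback.condition)

theorem letters_srcWord_domDiag (z : P.Diag c.arr) (a : Word (P.Ar z.lab.1))
    (ha : a.letters = P.positions z.lab.1) :
    (c.srcWord (c.domDiag z)).letters =
      (a.bind fun i => (c.srcWord (c.arrows z i).dom).map (c.incl z i)).letters := by
  rw [Word.letters_bind, ha]
  refine (c.word_letters _ _).trans ((P.positions_sub _ _ _).trans ?_)
  refine Multiset.bind_congr fun i _ => ?_
  exact ((Word.letters_map _ _).trans (congrArg _ (c.word_letters _ _))).symm

variable [SymmetricCategory W]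

open Word

theorem evalBind_eqToHom_evalBind_eqToHom {L L' L'' : Type w} (a : Word L) (ε : L → L')
    (ε' : L' → L'')
    {f : L → W} {g : L' → W} {h : L'' → W} (e : ∀ l, g (ε l) = f l) (e' : ∀ l, h (ε' l) = g l) :
    CohEquiv ((a.map ε).evalBind (fun l => .of (ε' l)) (fun l => eqToHom (e' l)) ≫
        a.evalBind (fun l => .of (ε l)) fun l => eqToHom (e l))
      (a.evalBind (fun l => .of (ε' (ε l))) fun l => eqToHom ((e' _).trans (e l))) := by
  refine (CohEquiv.evalBind_evalBind _ _ _ _ _).trans (CohEquiv.evalBind _ fun l => ?_)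
  exact .of_eq (eqToHom_trans (e' (ε l)) (e l))

theorem evalBind_arrMap (k : c.Arr) {L L' : Type (max u v)} (ε : P.Ar k.dom.lab.1 → L) (f : L → W)
    (hε : ∀ q, f (ε q) = labels k.dom q) (ε' : L → L') (f' : L' → W) (h : ∀ l, f' (ε' l) = f l) :
    CohEquiv (((c.srcWord k.dom).map ε).evalBind (fun l => .of (ε' l)) (fun l => eqToHom (h l)) ≫
        c.arrMap k ε f hε)
      (c.arrMap k (fun q => ε' (ε q)) f' (fun q => (h _).trans (hε q))) := by
  refine CohEquiv.trans (.of_eq (Category.assoc _ _ _).symm) (CohEquiv.comp_right ?_ _)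
  exact evalBind_eqToHom_evalBind_eqToHom _ _ _ _ _

theorem arrMap_congr (k : c.Arr) {L : Type (max u v)} {ε ε' : P.Ar k.dom.lab.1 → L} (f : L → W)
    (hε : ∀ q, f (ε q) = labels k.dom q) (e : ∀ q, ε q = ε' q) :
    CohEquiv (c.arrMap k ε f hε) (c.arrMap k ε' f (fun q => e q ▸ hε q)) := by
  obtain rfl : ε = ε' := funext e
  exact .of_eq rfl

/-- The working description of a composite: the rearrangement of positions disappears modulo
`CohEquiv`, leaving the tensor product of the arrows of `z` followed by `g`. -/
theorem srcHom_compArr (z : P.Diag c.arr) (g : c.Arr) (h : c.codDiag z = g.dom)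
    (e : (c.srcWord (c.codDiag z)).eval
      (labels (c.codDiag z)) = (c.srcWord g.dom).eval (labels g.dom)) :
    CohEquiv (f := labels (c.compArr z g h).dom) (c.srcHom (c.compArr z g h))
      (Word.evalBind (c.srcWord (c.codDiag z)) _ (fun i =>
        c.arrMap (c.arrows z i) (c.incl z i) (labels (c.compArr z g h).dom) (c.labels_incl z i)) ≫
          eqToHom e ≫ c.srcHom g) := by
  obtain ⟨d, x, g⟩ := g
  obtain rfl : _ = d := h
  have hl := c.letters_srcWord_domDiag z (c.srcWord (c.codDiag z)) (c.word_letters _ _)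
  refine CohEquiv.trans (.of_eq ?_) (CohEquiv.canon_comp hl _)
  have ht : c.tensorArr z = eqToHom (c.eval_srcWord (c.domDiag z)).symm ≫
      Word.canon (labels (c.domDiag z)) (c.srcWord (c.domDiag z)) _ hl ≫
      Word.evalBind (c.srcWord (c.codDiag z)) _ (fun i =>
        c.arrMap (c.arrows z i) (c.incl z i) (labels (c.domDiag z)) (c.labels_incl z i)) ≫
      eqToHom (c.eval_srcWord (c.codDiag z)) := rfl
  -- With all objects made variables, the equalities can be substituted and every transport becomes
  -- an identity.
  have key : ∀ {A A' B C C' D E : W} (h₁ : A = A') (h₂ : A' = A) (p : A ⟶ B) (q : B ⟶ C)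
      (h₃ : C = D) (h₄ : C = C') (h₅ : C' = D) (r : D ⟶ E),
      eqToHom h₁ ≫ (eqToHom h₂ ≫ p ≫ q ≫ eqToHom h₃) ≫ r =
        p ≫ q ≫ eqToHom h₄ ≫ eqToHom h₅ ≫ r := by
    intro A A' B C C' D E h₁ h₂ p q h₃ h₄ h₅ r
    subst h₁ h₄ h₅
    simp
  simp only [srcHom, compArr, ht, eqToHom_refl, Category.id_comp]
  exact key _ _ _ _ _ _ _ _

end TensorChoice

end PolyMonad

/-! ### The identity laws. -/

namespace PolyMonad

namespace TensorChoice

variable {P : PolyMonad.{max u v}} {W : Type u} [Category.{v} W] [MonoidalCategory W]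
  (c c' : P.TensorChoice W) [SymmetricCategory W]

open Word

/-- Two arrows with the same domain (as diagrams whose inputs are labelled without repetition by
elements of `N`) are equal when they are both induced, up to structural isomorphisms, by the same
morphism from a tensor product indexed by `N`. -/
theorem arr_eq_of_lab {N : Type (max u v)} (G : N → W × P.S) {l l' : P.Lab N} (e : l = l')
    (hl : Function.Injective l'.2) (ht : ∀ i, (P.smcOb W).hom (G (l.2 i)) = P.src l.1 i)
    (ht' : ∀ i, (P.smcOb W).hom (G (l'.2 i)) = P.src l'.1 i) {x : W}
    (m : c.src ⟨⟨l.1, fun p => G (l.2 p)⟩, ht⟩ ⟶ x)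
    (m' : c.src ⟨⟨l'.1, fun p => G (l'.2 p)⟩, ht'⟩ ⟶ x)
    (E : N → P.Ar l.1) (E' : N → P.Ar l'.1) (hE : ∀ n, l.2 (E n) = n) (hE' : ∀ n, l'.2 (E' n) = n)
    (a : Word N) (γ : a.eval (fun n => (G n).1) ⟶ x)
    (h : CohEquiv (f := fun p => (G (l.2 p)).1) (c.srcHom ⟨⟨⟨l.1, fun p => G (l.2 p)⟩, ht⟩, x, m⟩)
      (a.evalBind (fun n => .of (E n))
        (fun n => eqToHom (congrArg (fun n => (G n).1) (hE n))) ≫ γ))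
    (h' : CohEquiv (f := fun p => (G (l'.2 p)).1)
      (c.srcHom ⟨⟨⟨l'.1, fun p => G (l'.2 p)⟩, ht'⟩, x, m'⟩)
      (a.evalBind (fun n => .of (E' n))
        (fun n => eqToHom (congrArg (fun n => (G n).1) (hE' n))) ≫ γ)) :
    (⟨⟨⟨l.1, fun p => G (l.2 p)⟩, ht⟩, x, m⟩ : c.Arr) =
      ⟨⟨⟨l'.1, fun p => G (l'.2 p)⟩, ht'⟩, x, m'⟩ := by
  subst e
  -- Both are sections of the same injective labelling. Hence the two arrows are compared with
  -- literally the same morphism.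
  obtain rfl : E = E' := funext fun n => hl ((hE n).trans (hE' n).symm)
  have := P.finite_ar l.1
  refine Arr.ext_srcHom c rfl rfl fun _ => ?_
  rw [eqToHom_refl, eqToHom_refl, Category.comp_id, Category.id_comp]
  exact (h.trans h'.symm).eq (c.nodup_srcWord _)

theorem srcHom_idArr (x : W × P.S) : CohEquiv (c.srcHom (c.idArr x))
    (y := .of (P.pt x.2)) (𝟙 x.1) := by
  refine CohEquiv.trans (.of_eq ?_)
    (CohEquiv.canon_comp ((c.word_letters _ _).trans (P.positions_unit _)) _)
  have key : ∀ {A A' B : W} (h₁ : A = A') (h₂ : A' = A) (p : A ⟶ B),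
      eqToHom h₁ ≫ eqToHom h₂ ≫ p = p ≫ 𝟙 B := by
    intro A A' B h₁ h₂ p
    subst h₁
    simp
  exact key _ _ _

theorem arrMap_idArr (x : W × P.S) {L : Type (max u v)} (ε : P.Ar (P.unit x.2) → L) (f : L → W)
    (hε : ∀ q, f (ε q) = x.1) :
    CohEquiv (c.arrMap (c.idArr x) ε f hε) (y := .of (ε (P.pt x.2))) (eqToHom (hε _)) :=
  (CohEquiv.evalBind_comp _ _ (c.srcHom_idArr x)).trans (.of_eq (Category.comp_id _))

theorem srcHom_eq_evalBind (k : c.Arr) : CohEquiv (c.srcHom k)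
    ((c.srcWord k.dom).evalBind (fun q => .of q) (fun q => 𝟙 (labels k.dom q)) ≫ c.srcHom k) :=
  (CohEquiv.of_eq (Category.id_comp _).symm).trans ((CohEquiv.evalBind_of _ _).symm.comp_right _)

theorem compArr_idArr (k : c.Arr)
    (ht : ∀ i, c.arr.hom (c.idArr (k.dom.lab.2 i)) = P.src k.dom.lab.1 i)
    (h : c.codDiag ⟨⟨k.dom.lab.1, fun i => c.idArr (k.dom.lab.2 i)⟩, ht⟩ = k.dom) :
    c.compArr ⟨⟨k.dom.lab.1, fun i => c.idArr (k.dom.lab.2 i)⟩, ht⟩ k h = k := by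
  let z : P.Diag c.arr := ⟨⟨k.dom.lab.1, fun i => c.idArr (k.dom.lab.2 i)⟩, ht⟩
  -- The positions of the domain of `k` serve as index type; both sides are induced by the morphism
  -- of `k` itself.
  refine c.arr_eq_of_lab (N := P.Ar k.dom.lab.1) k.dom.lab.2
    (l := P.bind k.dom.lab.1 (fun i => ⟨P.unit (k.dom.lab.2 i).2, fun _ => i⟩) ht)
    (l' := ⟨k.dom.lab.1, fun i => i⟩) ?_ Function.injective_id
    (c.domDiag z).typed k.dom.typed
    (c.compArr z k h).hom k.hom (fun i => c.incl z i (P.pt _)) (fun i => i)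
    (fun i => P.bind_snd_pos k.dom.lab.1 (fun i => ⟨P.unit (k.dom.lab.2 i).2, fun _ => i⟩) _ i _)
    (fun _ => rfl) (c.srcWord k.dom) (c.srcHom k) ?_ (c.srcHom_eq_evalBind k)
  -- The colour of a label equals the colour of its position only propositionally, so the colours
  -- are generalized before the unit law of `P` is applied.
  · have key : ∀ (g : ∀ i : P.Ar k.dom.lab.1, P.S) (hg : ∀ i, g i = P.src k.dom.lab.1 i)
        (h : ∀ i, P.tgt (P.unit (g i)) = P.src k.dom.lab.1 i),
        P.bind k.dom.lab.1 (fun i => ⟨P.unit (g i), fun _ => i⟩) h =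
          ⟨k.dom.lab.1, fun i => i⟩ := by
      intro g hg h
      obtain rfl : g = P.src k.dom.lab.1 := funext hg
      exact P.bind_unit_right _ _ _ _
    exact key _ k.dom.typed _
  · refine (c.srcHom_compArr z k h rfl).trans ?_
    refine (CohEquiv.comp_right (CohEquiv.evalBind _ fun i =>
      c.arrMap_idArr (k.dom.lab.2 i) (c.incl z i) _ (c.labels_incl z i)) _).trans (.of_eq ?_)
    exact congrArg (fun m => _ ≫ m) (Category.id_comp (c.srcHom k))

theorem idArr_compArr (k : c.Arr)
    (ht : ∀ i : P.Ar (P.unit (P.tgt k.dom.lab.1)), P.tgt k.dom.lab.1 = P.src _ i)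
    (h : c.codDiag ⟨⟨P.unit (P.tgt k.dom.lab.1), fun _ => k⟩, ht⟩ =
      (c.idArr (k.cod, P.tgt k.dom.lab.1)).dom) :
    c.compArr ⟨⟨P.unit (P.tgt k.dom.lab.1), fun _ => k⟩, ht⟩
      (c.idArr (k.cod, P.tgt k.dom.lab.1)) h = k := by
  let z : P.Diag c.arr := ⟨⟨P.unit (P.tgt k.dom.lab.1), fun _ => k⟩, ht⟩
  -- The same index type as for the other identity law; the labelled operations now agree by the
  -- left unit law of `P`.
  refine c.arr_eq_of_lab (N := P.Ar k.dom.lab.1) k.dom.lab.2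
    (l := P.bind (P.unit (P.tgt k.dom.lab.1)) (fun _ => ⟨k.dom.lab.1, fun q => q⟩) ht)
    (l' := ⟨k.dom.lab.1, fun q => q⟩) (P.bind_unit_left _ _ _ _) Function.injective_id
    (c.domDiag z).typed k.dom.typed
    (c.compArr z (c.idArr (k.cod, P.tgt k.dom.lab.1)) h).hom k.hom
    (fun q => c.incl z (P.pt _) q) (fun q => q)
    (fun q => P.bind_snd_pos (P.unit (P.tgt k.dom.lab.1)) (fun _ => ⟨k.dom.lab.1, fun q => q⟩)
      _ (P.pt _) q)
    (fun _ => rfl) (c.srcWord k.dom) (c.srcHom k) ?_ (c.srcHom_eq_evalBind k)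
  refine (c.srcHom_compArr z _ h rfl).trans ?_
  refine (CohEquiv.evalBind_comp _ _ ((CohEquiv.of_eq (Category.id_comp _)).trans
    (c.srcHom_idArr (k.cod, P.tgt k.dom.lab.1)))).trans (.of_eq ?_)
  exact Category.comp_id _

end TensorChoice

end PolyMonad

/-! ### Associativity of composition. -/

namespace PolyMonad

namespace TensorChoice

variable {P : PolyMonad.{max u v}} {W : Type u} [Category.{v} W] [MonoidalCategory W]
  (c c' : P.TensorChoice W) [SymmetricCategory W]

open Word

theorem arrMap_compArr (z : P.Diag c.arr) (g : c.Arr) (h : c.codDiag z = g.dom)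
    (e : (c.srcWord (c.codDiag z)).eval (labels (c.codDiag z)) =
      (c.srcWord g.dom).eval (labels g.dom)) {L : Type (max u v)}
    (ε : P.Ar (c.domDiag z).lab.1 → L) (f : L → W)
    (hε : ∀ q, f (ε q) = labels (c.domDiag z) q) :
    CohEquiv (c.arrMap (c.compArr z g h) ε f hε)
      (Word.evalBind (c.srcWord (c.codDiag z)) _ (fun i =>
        c.arrMap (c.arrows z i) (fun q => ε (c.incl z i q)) f
          (fun q => (hε _).trans (c.labels_incl z i q))) ≫ eqToHom e ≫ c.srcHom g) := by
  refine (CohEquiv.evalBind_comp _ _ (c.srcHom_compArr z g h e)).trans ?_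
  refine (CohEquiv.of_eq (Category.assoc _ _ _).symm).trans (CohEquiv.comp_right ?_ _)
  refine (CohEquiv.evalBind_evalBind _ _ _ _ _).trans (CohEquiv.evalBind _ fun i => ?_)
  exact c.evalBind_arrMap _ _ _ _ _ _ _

/-- Moves a relabelling `E` of positions through two levels of tensor products to the innermost
arrows. It is applied once for each bracketing of a threefold composite. -/
theorem evalBind_evalBind_arrMap {I N M : Type (max u v)} {J : I → Type (max u v)} (a : Word I)
    (b : ∀ i, Word (J i)) (K : ∀ i, J i → c.Arr) (ν : ∀ i j, P.Ar (K i j).dom.lab.1 → N)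
    (F : N → W) (hν : ∀ i j q, F (ν i j q) = labels (K i j).dom q) (E : N → M) (f : M → W)
    (y : ∀ n, f (E n) = F n) {w : I → W} (g : ∀ i, (b i).eval (fun j => (K i j).cod) ⟶ w i) {x : W}
    (τ : a.eval w ⟶ x) :
    CohEquiv (Word.evalBind (a.bind fun i => (b i).bind fun j => (c.srcWord (K i j).dom).map (ν i j))
        (fun n => .of (E n)) (fun n => eqToHom (y n)) ≫
        a.evalBind _ (fun i => (b i).evalBind _ (fun j => c.arrMap (K i j) (ν i j) F (hν i j)) ≫ g i) ≫
        τ)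
      (a.evalBind _ (fun i => (b i).evalBind _ (fun j => c.arrMap (K i j) (fun q => E (ν i j q)) f
        (fun q => (y _).trans (hν i j q))) ≫ g i) ≫ τ) := by
  refine (CohEquiv.of_eq (Category.assoc _ _ _).symm).trans (CohEquiv.comp_right ?_ _)
  refine (CohEquiv.evalBind_evalBind _ _ _ _ _).trans (CohEquiv.evalBind _ fun i => ?_)
  refine (CohEquiv.of_eq (Category.assoc _ _ _).symm).trans (CohEquiv.comp_right ?_ _)
  refine (CohEquiv.evalBind_evalBind _ _ _ _ _).trans (CohEquiv.evalBind _ fun j => ?_)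
  exact c.evalBind_arrMap _ _ _ _ _ _ _

/-- Both bracketings reduce to one three-level tensor product: the innermost arrows, the middle
arrows, then `k`. The middle arrows are given with domain `c.codDiag (z i)`, so that the inner
composites are formed with `rfl`. -/
theorem compArr_compArr (o : P.Op) (z : P.Ar o → P.Diag c.arr) (w : P.Ar o → W)
    (m : ∀ i, c.src (c.codDiag (z i)) ⟶ w i)
    (htL : ∀ i, c.arr.hom (c.compArr (z i) ⟨c.codDiag (z i), w i, m i⟩ rfl) = P.src o i)
    (htG : ∀ i, P.tgt (c.codDiag (z i)).lab.1 = P.src o i)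
    (htZ : ∀ i, P.tgt (z i).lab.1 = P.src o i) (k : c.Arr)
    (hL : c.codDiag ⟨⟨o, fun i => c.compArr (z i) ⟨c.codDiag (z i), w i, m i⟩ rfl⟩, htL⟩ = k.dom)
    (hG : c.codDiag ⟨⟨o, fun i => (⟨c.codDiag (z i), w i, m i⟩ : c.Arr)⟩, htG⟩ = k.dom)
    (hR : c.codDiag ((P.monad.μ.app c.arr).left (⟨⟨o, z⟩, htZ⟩ : P.Diag (P.extObj c.arr))) =
      c.domDiag ⟨⟨o, fun i => (⟨c.codDiag (z i), w i, m i⟩ : c.Arr)⟩, htG⟩) :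
    c.compArr ⟨⟨o, fun i => c.compArr (z i) ⟨c.codDiag (z i), w i, m i⟩ rfl⟩, htL⟩ k hL =
      c.compArr ((P.monad.μ.app c.arr).left (⟨⟨o, z⟩, htZ⟩ : P.Diag (P.extObj c.arr)))
        (c.compArr ⟨⟨o, fun i => (⟨c.codDiag (z i), w i, m i⟩ : c.Arr)⟩, htG⟩ k hG) hR := by
  let ZL : P.Diag c.arr :=
    ⟨⟨o, fun i => c.compArr (z i) ⟨c.codDiag (z i), w i, m i⟩ rfl⟩, htL⟩
  let ZG : P.Diag c.arr := ⟨⟨o, fun i => (⟨c.codDiag (z i), w i, m i⟩ : c.Arr)⟩, htG⟩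
  let ZR : P.Diag c.arr :=
    (P.monad.μ.app c.arr).left (⟨⟨o, z⟩, htZ⟩ : P.Diag (P.extObj c.arr))
  let K (i : P.Ar o) (j : P.Ar (z i).lab.1) : c.Arr := c.arrows (z i) j
  -- A position of the total composite is an input of `o`, an input of the diagram there, and an
  -- input of the domain of the arrow there. The labelled operations `l` and `l'` are the two
  -- iterated composites labelled by such triples.
  let N := Σ i, Σ j, P.Ar (K i j).dom.lab.1
  let G (n : N) : W × P.S := (K n.1 n.2.1).dom.lab.2 n.2.2
  let Φ (s : Σ i, P.Ar (z i).lab.1) : P.Lab N :=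
    ⟨(K s.1 s.2).dom.lab.1, fun q => ⟨s.1, s.2, q⟩⟩
  let l : P.Lab N := P.bind o (fun i => P.bind (z i).lab.1 (fun j => Φ ⟨i, j⟩) (z i).typed) htL
  let l' : P.Lab N := P.bind (P.sub o (fun i => (z i).lab.1) htZ)
    (fun n => Φ ((P.pos o (fun i => (z i).lab.1) htZ).symm n)) ZR.typed
  have hl : l = l' := by
    refine Eq.symm ((P.bind_assoc _ o (fun i => (z i).lab.1) _ _ _).trans ?_)
    refine Tree.bind_congr (fun i => ?_) _
    refine Tree.bind_congr (fun j => ?_) _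
    exact congrArg Φ (Equiv.symm_apply_apply _ _)
  let E (n : N) : P.Ar l.1 := c.incl ZL n.1 (c.incl (z n.1) n.2.1 n.2.2)
  have hE : ∀ n, l.2 (E n) = n := fun n =>
    (P.bind_snd_pos o (fun i => P.bind (z i).lab.1 (fun j => Φ ⟨i, j⟩) (z i).typed) htL n.1
      (c.incl (z n.1) n.2.1 n.2.2)).trans
      (P.bind_snd_pos (z n.1).lab.1 (fun j => Φ ⟨n.1, j⟩) (z n.1).typed n.2.1 n.2.2)
  -- By surjectivity of `pos`, applied twice, every position comes from a triple. Thus `l.2` is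
  -- bijective, and the equality `hl` transfers this to `l'.2`.
  have hE₂ : ∀ p, E (l.2 p) = p := by
    intro p
    obtain ⟨⟨i, p⟩, rfl⟩ := (P.pos o (fun i =>
      (P.bind (z i).lab.1 (fun j => Φ ⟨i, j⟩) (z i).typed).1) htL).surjective p
    obtain ⟨⟨j, q⟩, rfl⟩ := (P.pos (z i).lab.1 (fun j => (Φ ⟨i, j⟩).1) (z i).typed).surjective p
    exact congrArg E (hE ⟨i, j, q⟩)
  have hinj : Function.Injective l'.2 := hl ▸ Function.LeftInverse.injective hE₂
  have hsurj : ∀ n, ∃ p, l'.2 p = n := hl ▸ fun n => ⟨E n, hE n⟩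
  choose E' hE' using hsurj
  let a : Word (P.Ar o) := c.srcWord (c.codDiag ZL)
  let b (i : P.Ar o) : Word (P.Ar (z i).lab.1) := c.srcWord (c.codDiag (z i))
  let g (i : P.Ar o) : (b i).eval (fun j => (K i j).cod) ⟶ w i :=
    c.srcHom ⟨c.codDiag (z i), w i, m i⟩
  have eL : a.eval w = (c.srcWord k.dom).eval (labels k.dom) :=
    congrArg (fun t => (c.srcWord t).eval (labels t)) hL
  let τ : a.eval w ⟶ k.cod := eqToHom eL ≫ c.srcHom k
  refine c.arr_eq_of_lab (N := N) G hl hinj (c.domDiag ZL).typed (c.domDiag ZR).typed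
    (c.compArr ZL k hL).hom (c.compArr ZR (c.compArr ZG k hG) hR).hom E E' hE hE'
    (a.bind fun i => (b i).bind fun j =>
      (c.srcWord (K i j).dom).map fun q => (⟨i, j, q⟩ : N))
    (a.evalBind _ (fun i => (b i).evalBind _ (fun j =>
      c.arrMap (K i j) (fun q => (⟨i, j, q⟩ : N)) (fun n => (G n).1) fun _ => rfl) ≫ g i) ≫ τ)
    (CohEquiv.trans ?_ (c.evalBind_evalBind_arrMap a b K _ _ _ E _ _ g τ).symm)
    (CohEquiv.trans ?_ (c.evalBind_evalBind_arrMap a b K _ _ _ E' _ _ g τ).symm)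
  · refine (c.srcHom_compArr ZL k hL eL).trans (CohEquiv.comp_right ?_ _)
    refine CohEquiv.evalBind _ fun i => ?_
    refine (c.arrMap_compArr (z i) _ rfl rfl _ _ _).trans (.of_eq ?_)
    exact congrArg (fun m => _ ≫ m) (Category.id_comp (g i))
  · refine (c.srcHom_compArr ZR _ hR rfl).trans ?_
    refine (CohEquiv.evalBind_comp _ _ ((CohEquiv.of_eq (Category.id_comp _)).trans
      (c.srcHom_compArr ZG k hG eL))).trans ?_
    refine (CohEquiv.of_eq (Category.assoc _ _ _).symm).trans (CohEquiv.comp_right ?_ _)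
    refine (CohEquiv.evalBind_evalBind _ _ _ _ _).trans (CohEquiv.evalBind _ fun i => ?_)
    refine (CohEquiv.of_eq (Category.assoc _ _ _).symm).trans (CohEquiv.comp_right ?_ _)
    refine (CohEquiv.evalBind_evalBind _ _ _ _ _).trans (CohEquiv.evalBind _ fun j => ?_)
    -- The arrow of `ZR` at `n` is found through the inverse of `pos`. Treating that pair as a
    -- variable `s` allows the dependent data to be rewritten; injectivity of `l'.2` then identifies
    -- the positions.
    have key : ∀ (n : P.Ar (P.sub o (fun i => (z i).lab.1) htZ)) (s : Σ i, P.Ar (z i).lab.1)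
        (_ : (P.pos o (fun i => (z i).lab.1) htZ).symm n = s)
        (e : Arr.cod (c.arrows ZR n) = (K s.1 s.2).cod),
        CohEquiv (c.arrMap (c.arrows ZR n) (c.incl ZR n) _ (c.labels_incl ZR n) ≫ eqToHom e)
          (c.arrMap (K s.1 s.2) (fun q => E' ⟨s.1, s.2, q⟩) (fun p => (G (l'.2 p)).1)
            fun q => congrArg (fun n => (G n).1) (hE' _)) := by
      rintro n _ rfl e
      refine (CohEquiv.of_eq (Category.comp_id _)).trans ?_
      refine c.arrMap_congr _ _ _ fun q => hinj (Eq.trans ?_ (hE' _).symm)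
      exact P.bind_snd_pos (P.sub o (fun i => (z i).lab.1) htZ)
        (fun n => Φ ((P.pos o (fun i => (z i).lab.1) htZ).symm n)) ZR.typed n q
    exact key _ ⟨i, j⟩ (Equiv.symm_apply_apply _ _) _

end TensorChoice

end PolyMonad

/-! ### Comparison of two tensor choices. -/

namespace PolyMonad

namespace TensorChoice

variable {P : PolyMonad.{max u v}} {W : Type u} [Category.{v} W] [MonoidalCategory W]
  (c c' : P.TensorChoice W) [SymmetricCategory W]

open Word

theorem srcHom_changeArr (k : c.Arr) : CohEquiv (c'.srcHom (c.changeArr c' k)) (c.srcHom k) := by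
  refine CohEquiv.trans (.of_eq ?_)
    (CohEquiv.canon_comp ((c'.word_letters _ _).trans (c.word_letters _ _).symm) _)
  have key : ∀ {A A' B : W} (h₁ : A = A') (h₂ : A' = A) (p : A ⟶ B),
      eqToHom h₁ ≫ eqToHom h₂ ≫ p = p := by
    intro A A' B h₁ h₂ p
    subst h₁
    simp
  exact key _ _ _

theorem arr_eq_of_cohEquiv {t : P.Diag (P.smcOb W)} {x : W} (m m' : c.src t ⟶ x)
    (h : CohEquiv (f := labels t) (c.srcHom ⟨t, x, m⟩) (c.srcHom ⟨t, x, m'⟩)) :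
    (⟨t, x, m⟩ : c.Arr) = ⟨t, x, m'⟩ := by
  have := P.finite_ar t.lab.1
  refine Arr.ext_srcHom c rfl rfl fun _ => ?_
  rw [eqToHom_refl, eqToHom_refl, Category.comp_id, Category.id_comp]
  exact h.eq (c.nodup_srcWord _)

theorem changeArr_changeArr (k : c.Arr) : c'.changeArr c (c.changeArr c' k) = k :=
  c.arr_eq_of_cohEquiv _ k.hom ((c'.srcHom_changeArr c _).trans (c.srcHom_changeArr c' k))

theorem changeArr_idArr (x : W × P.S) : c.changeArr c' (c.idArr x) = c'.idArr x :=
  c'.arr_eq_of_cohEquiv _ (c'.idArr x).hom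
    ((c.srcHom_changeArr c' _).trans ((c.srcHom_idArr x).trans (c'.srcHom_idArr x).symm))

theorem arrMap_changeArr (k : c.Arr) {L : Type (max u v)} (ε : P.Ar k.dom.lab.1 → L) (f : L → W)
    (hε : ∀ q, f (ε q) = labels k.dom q) :
    CohEquiv (c'.arrMap (c.changeArr c' k) ε f hε) (c.arrMap k ε f hε) :=
  CohEquiv.evalBind_comp _ _ (c.srcHom_changeArr c' k)

/-- `changeArr` does not affect an arrow modulo `CohEquiv`. By `srcHom_compArr` both sides are
therefore equivalent to the same tensor of arrows followed by `g`, although the two choices use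
different words. -/
theorem changeArr_compArr (z : P.Diag c.arr) (g : c.Arr) (h : c.codDiag z = g.dom)
    (h' : c'.codDiag ((P.monad.map (c.change c')).left z) = (c.changeArr c' g).dom) :
    c.changeArr c' (c.compArr z g h) =
      c'.compArr ((P.monad.map (c.change c')).left z) (c.changeArr c' g) h' := by
  obtain ⟨d, x, g⟩ := g
  obtain rfl : _ = d := h
  refine c'.arr_eq_of_cohEquiv (c.changeArr c' (c.compArr z ⟨_, x, g⟩ rfl)).hom
    (c'.compArr _ _ h').hom (CohEquiv.trans (c.srcHom_changeArr c' (c.compArr z ⟨_, x, g⟩ rfl)) ?_)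
  refine ((c.srcHom_compArr z ⟨_, x, g⟩ rfl rfl).trans ?_).trans
    (c'.srcHom_compArr ((P.monad.map (c.change c')).left z) _ h' rfl).symm
  let k : c.Arr := ⟨c.codDiag z, x, g⟩
  refine (CohEquiv.evalBind_comp _ _ ((CohEquiv.of_eq (Category.id_comp (c.srcHom k))).trans
    ((c.srcHom_changeArr c' k).symm.trans
      (.of_eq (Category.id_comp (c'.srcHom (c.changeArr c' k))).symm)))).trans ?_
  refine CohEquiv.comp_right (CohEquiv.evalBind _ fun i => ?_) _
  exact (c.arrMap_changeArr c' (c.arrows z i) (c.incl z i) _ (c.labels_incl z i)).symm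

/-! ### From elementwise laws to morphisms out of pullbacks. -/

theorem compArr_congr {z z' : P.Diag c.arr} {g g' : c.Arr} (hz : z = z') (hg : g = g')
    (h : c.codDiag z = g.dom) (h' : c.codDiag z' = g'.dom) :
    c.compArr z g h = c.compArr z' g' h' := by
  subst hz hg
  rfl

theorem compArr_compArr' (o : P.Op) (z : P.Ar o → P.Diag c.arr) (g : P.Ar o → c.Arr)
    (h : ∀ i, c.codDiag (z i) = (g i).dom)
    (htL : ∀ i, c.arr.hom (c.compArr (z i) (g i) (h i)) = P.src o i)
    (htG : ∀ i, P.tgt (g i).dom.lab.1 = P.src o i)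
    (htZ : ∀ i, P.tgt (z i).lab.1 = P.src o i) (k : c.Arr)
    (hL : c.codDiag ⟨⟨o, fun i => c.compArr (z i) (g i) (h i)⟩, htL⟩ = k.dom)
    (hG : c.codDiag ⟨⟨o, g⟩, htG⟩ = k.dom)
    (hR : c.codDiag ((P.monad.μ.app c.arr).left (⟨⟨o, z⟩, htZ⟩ : P.Diag (P.extObj c.arr))) =
      c.domDiag ⟨⟨o, g⟩, htG⟩) :
    c.compArr ⟨⟨o, fun i => c.compArr (z i) (g i) (h i)⟩, htL⟩ k hL =
      c.compArr ((P.monad.μ.app c.arr).left (⟨⟨o, z⟩, htZ⟩ : P.Diag (P.extObj c.arr)))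
        (c.compArr ⟨⟨o, g⟩, htG⟩ k hG) hR := by
  -- Transporting each middle arrow along the equality of its domain with `c.codDiag (z i)` brings
  -- it to the form required by `compArr_compArr`.
  obtain ⟨w, m, rfl⟩ : ∃ (w : P.Ar o → W) (m : ∀ i, c.src (c.codDiag (z i)) ⟶ w i),
      g = fun i => ⟨c.codDiag (z i), w i, m i⟩ := by
    refine ⟨fun i => (g i).cod, fun i => eqToHom (congrArg c.src (h i)) ≫ (g i).hom,
      funext fun i => ?_⟩
    have key : ∀ (t : P.Diag (P.smcOb W)) (g : c.Arr) (e : t = g.dom),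
        g = ⟨t, g.cod, eqToHom (congrArg c.src e) ≫ g.hom⟩ := by
      rintro _ g rfl
      simp
    exact key _ _ (h i)
  exact c.compArr_compArr o z w m htL htG htZ k hL hG hR

/-- The axioms are stated with `pullback.lift`; at an element they become identities between values
of `compArr`. -/
theorem lift_comp_left {X : Over P.S} (p : X ⟶ P.monad.obj c.arr) (q : X ⟶ c.arr)
    (e : p ≫ P.monad.map c.arrCod = q ≫ c.arrDom) (x : X.left) :
    (pullback.lift p q e ≫ c.comp).left x = c.compArr (p.left x) (q.left x)
      (congrArg (fun f : X ⟶ P.monad.obj (P.smcOb W) => f.left x) e) :=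
  c.compArr_congr
    (congrArg (fun f : X ⟶ P.monad.obj c.arr => f.left x) (pullback.lift_fst p q e))
    (congrArg (fun f : X ⟶ c.arr => f.left x) (pullback.lift_snd p q e))
    (congrArg (fun f : pullback (P.monad.map c.arrCod) c.arrDom ⟶ P.monad.obj (P.smcOb W) =>
      f.left ((pullback.lift p q e).left x)) pullback.condition)
    _

theorem comp_arrCod :
    c.comp ≫ c.arrCod = pullback.snd (P.monad.map c.arrCod) c.arrDom ≫ c.arrCod := by
  ext x
  exact Prod.ext rfl ((P.left_hom (c.comp ≫ c.arrCod) x).trans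
    (P.left_hom (pullback.snd (P.monad.map c.arrCod) c.arrDom ≫ c.arrCod) x).symm)

theorem comp_comp_left (y : P.Diag (pullback (P.monad.map c.arrCod) c.arrDom)) (k : c.Arr)
    (hL : c.codDiag ((P.monad.map c.comp).left y) = k.dom)
    (hG : c.codDiag ((P.monad.map (pullback.snd (P.monad.map c.arrCod) c.arrDom)).left y) = k.dom)
    (hR : c.codDiag ((P.monad.μ.app c.arr).left ((P.monad.map
          (pullback.fst (P.monad.map c.arrCod) c.arrDom)).left y)) =
        c.domDiag ((P.monad.map (pullback.snd (P.monad.map c.arrCod) c.arrDom)).left y)) :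
    c.compArr ((P.monad.map c.comp).left y) k hL =
      c.compArr ((P.monad.μ.app c.arr).left ((P.monad.map
          (pullback.fst (P.monad.map c.arrCod) c.arrDom)).left y))
        (c.compArr ((P.monad.map (pullback.snd (P.monad.map c.arrCod) c.arrDom)).left y) k hG) hR :=
  c.compArr_compArr' y.lab.1
    (fun i => (pullback.fst (P.monad.map c.arrCod) c.arrDom).left (y.lab.2 i))
    (fun i => (pullback.snd (P.monad.map c.arrCod) c.arrDom).left (y.lab.2 i))
    (fun i => congrArg (fun f : pullback (P.monad.map c.arrCod) c.arrDom ⟶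
      P.monad.obj (P.smcOb W) => f.left (y.lab.2 i)) pullback.condition)
    ((P.monad.map c.comp).left y).typed
    ((P.monad.map (pullback.snd (P.monad.map c.arrCod) c.arrDom)).left y).typed
    ((P.monad.map (pullback.fst (P.monad.map c.arrCod) c.arrDom)).left y).typed k hL hG hR

theorem codDiag_map_snd (y : P.Diag (pullback (P.monad.map c.arrCod) c.arrDom)) :
    c.codDiag ((P.monad.map (pullback.snd (P.monad.map c.arrCod) c.arrDom)).left y) =
      c.codDiag ((P.monad.map c.comp).left y) :=
  congrArg (fun f : pullback (P.monad.map c.arrCod) c.arrDom ⟶ P.smcOb W =>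
    (P.monad.map f).left y) c.comp_arrCod.symm

/-- Associativity for an arbitrary pair of maps `y` and `k` with the stated compatibilities; the
axiom is the case of the two pullback projections. -/
theorem comp_comp {X : Over P.S} (y : X ⟶ P.monad.obj (pullback (P.monad.map c.arrCod) c.arrDom))
    (k : X ⟶ c.arr) (hL : (y ≫ P.monad.map c.comp) ≫ P.monad.map c.arrCod = k ≫ c.arrDom)
    (hG : (y ≫ P.monad.map (pullback.snd (P.monad.map c.arrCod) c.arrDom)) ≫
      P.monad.map c.arrCod = k ≫ c.arrDom)
    (hR : (y ≫ P.monad.map (pullback.fst (P.monad.map c.arrCod) c.arrDom) ≫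
      P.monad.μ.app c.arr) ≫ P.monad.map c.arrCod = (pullback.lift
        (y ≫ P.monad.map (pullback.snd (P.monad.map c.arrCod) c.arrDom)) k hG ≫ c.comp) ≫
          c.arrDom) :
    pullback.lift (y ≫ P.monad.map c.comp) k hL ≫ c.comp =
      pullback.lift (y ≫ P.monad.map (pullback.fst (P.monad.map c.arrCod) c.arrDom) ≫
        P.monad.μ.app c.arr) (pullback.lift
        (y ≫ P.monad.map (pullback.snd (P.monad.map c.arrCod) c.arrDom)) k hG ≫ c.comp) hR ≫
          c.comp := by
  ext x
  have hL' : c.codDiag ((P.monad.map c.comp).left (y.left x)) = (k.left x).dom :=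
    congrArg (fun f : X ⟶ P.monad.obj (P.smcOb W) => f.left x) hL
  refine (c.lift_comp_left _ _ hL x).trans ((c.comp_comp_left (y.left x) (k.left x) hL'
    ((c.codDiag_map_snd _).trans hL') (c.codDiag_map_fst _)).trans ?_)
  refine Eq.trans ?_ (c.lift_comp_left _ _ hR x).symm
  exact c.compArr_congr rfl (c.lift_comp_left _ _ hG x).symm _ _

theorem isMulticategory_multicat : c.multicat.IsMulticategory where
  ids_dom := rfl
  ids_cod := by
    ext x
    exact Prod.ext rfl (P.tgt_unit _)
  comp_dom := rfl
  comp_cod := c.comp_arrCod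
  comp_ids := by
    ext k
    exact (c.lift_comp_left _ _ _ k).trans (c.compArr_idArr k _ _)
  ids_comp := by
    ext k
    exact (c.lift_comp_left _ _ _ k).trans (c.idArr_compArr k _ _)
  assoc := c.comp_comp _ _ _ _ _

/-- The inverse is the comparison in the opposite direction: by coherence, both round trips are
identities. -/
theorem exists_hom_change : ∃ F : c.multicat.Hom c'.multicat,
    F.onOb = 𝟙 _ ∧ F.onArr = c.change c' ∧ IsIso F.onArr := by
  refine ⟨⟨𝟙 _, c.change c', ?_, ?_, ?_, ?_⟩, rfl, rfl, c'.change c, ?_, ?_⟩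
  · rfl
  · rfl
  · ext x
    exact c.changeArr_idArr c' x
  · ext x
    exact (c.changeArr_compArr c' _ _
      (congrArg (fun f : pullback (P.monad.map c.arrCod) c.arrDom ⟶ P.monad.obj (P.smcOb W) =>
        f.left x) pullback.condition) _).trans (c'.lift_comp_left
      (pullback.fst (P.monad.map c.arrCod) c.arrDom ≫ P.monad.map (c.change c'))
      (pullback.snd (P.monad.map c.arrCod) c.arrDom ≫ c.change c') _ x).symm
  · ext k
    exact c.changeArr_changeArr c' k
  · ext k
    exact c'.changeArr_changeArr c k

end TensorChoice

end PolyMonad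

/-! ### The proposition, as the case of the opetopic polynomial monads. -/

theorem proposition3p4p1 (n : ℕ) (W : Type u) [Category.{v} W] [MonoidalCategory W]
    [SymmetricCategory W] :
    IsMonadOpfunctor (opetopic.{max u v} n).monad (ofTypeMonad.{max u v} Multiset)
      (Over.forget (opetopic.{max u v} n).S) (opetopic.{max u v} n).theta ∧
    Nonempty ((opetopic.{max u v} n).TensorChoice W) ∧
    (∀ τ : Multiset W → W, (∀ m, ∃ a : Word W, a.letters = m ∧ a.eval (fun x => x) = τ m) →
      ∃ c : (opetopic.{max u v} n).TensorChoice W, c.tensor = τ) ∧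
    (∀ c : (opetopic.{max u v} n).TensorChoice W, c.multicat.IsMulticategory) ∧
    ∀ c c' : (opetopic.{max u v} n).TensorChoice W,
      ∃ F : c.multicat.Hom c'.multicat, F.onOb = 𝟙 _ ∧ F.onArr = c.change c' ∧ IsIso F.onArr :=
  ⟨PolyMonad.isMonadOpfunctor_theta _, PolyMonad.nonempty_tensorChoice _,
    PolyMonad.exists_tensorChoice _, fun c => c.isMulticategory_multicat,
    fun c c' => c.exists_hom_change c'⟩
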